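/- Let $A\in\mathbb R^{n\times n}$, $b,c,k\in\mathbb R^n$, let $\varphi_0:\mathbb R\to\mathbb R^n$ and $\varphi:\mathbb R\to\mathbb R^m$ be continuous (hence bounded on bounded sets), and consider the master system $$\dot x=Ax+\varphi_0(y)+b\,\varphi(y)^T\theta,\qquad y=c^Tx,\qquad(1)$$ with constant parameter $\theta\in\mathbb R^m$. Assume that for every $\theta\in\mathbb R^m$ and every initial state $x(0)$ system (1) has a solution on $[0,\infty)$ and that every such solution is bounded. Assume that $F=A-kc^T$ is Hurwitz, and put $H(p)=c^T(pI-F)^{-1}b$; for a scalar signal $u$, $H(p)[u]$ denotes $c^Tz$, where $\dot z=Fz+bu$ with arbitrary initial state $z(0)$. Write $\varphi(t)=\varphi(y(t))$. The closed loop consists of (1), the observer $$\dot{\hat x}=A\hat x+\varphi_0(y)+b\,\varphi(y)^T\hat\theta+k(y-\hat y),\qquad \hat y=c^T\hat x,$$ and the adaptation law $$\dot{\hat\theta}=\gamma\,\hat e\,\omega,\qquad \omega=H(p)[\varphi(t)]\ \text{(componentwise)},\qquad \hat e=(y-\hat y)+H(p)\big[\varphi(t)^T\hat\theta\big]-\omega^T\hat\theta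 .$$ Then, for every $\gamma>0$ and every $\theta\in\mathbb R^m$: (i) for all initial conditions (of $x$, $\hat x$, $\hat\theta$ and of the states of the filters $H(p)$) the closed loop has a solution on $[0,\infty)$, and along every such solution all signals (the states $x,\hat x,\hat\theta$, the filter states, and $y$, $\hat y$, $\varphi_0(y)$, $\varphi(y)$, $\omega$, $H(p)[\varphi^T\hat\theta]$, $\hat e$) are bounded on $[0,\infty)$ and $\lim_{t\to\infty}(y(t)-\hat y(t))=0$; (ii) if along the solution $\varphi(t)$ is persistently exciting, i.e. it is measurable and bounded on $[0,\infty)$ and there are $\alpha,T>0$ with $\int_t^{t+T}\varphi(s)\varphi(s)^T\,ds\ge\alpha I$ for all $t\ge0$, and if $H$ is minimum phase, i.e. all its finite zeros lie in the open left half-plane (in particular $H\not\equiv0$), then in addition $\lim_{t\to\infty}|\theta-\hat\theta(t)|=0$. -/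

import Mathlib

open Set Filter Topology Matrix

/-- Data of the master system `x' = A x + φ₀(y) + b φ(y)ᵀ θ`, `y = cᵀ x`. -/
structure Plant (n m : ℕ) where
  A : Matrix (Fin n) (Fin n) ℝ
  b : Fin n → ℝ
  c : Fin n → ℝ
  φ₀ : ℝ → Fin n → ℝ
  φ : ℝ → Fin m → ℝ

/-- A signal on `[0, ∞)` is bounded (values at negative times are irrelevant). -/
def BoundedSignal {E : Type*} [Norm E] (f : ℝ → E) : Prop :=
  ∃ M : ℝ, ∀ t : ℝ, 0 ≤ t → ‖f t‖ ≤ M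

/-- `x` solves `x' = A x + φ₀(y) + b φ(y)ᵀ θ`, `y = cᵀ x` on `[0, ∞)`
(one-sided derivative at `0`). -/
def Plant.IsMasterSolution {n m : ℕ} (P : Plant n m) (θ : Fin m → ℝ)
    (x : ℝ → Fin n → ℝ) : Prop :=
  ∀ t : ℝ, 0 ≤ t →
    HasDerivWithinAt x
      (P.A *ᵥ x t + P.φ₀ (P.c ⬝ᵥ x t) + (P.φ (P.c ⬝ᵥ x t) ⬝ᵥ θ) • P.b) (Ici 0) t

/-- For every parameter value and every initial state the master system has a solution on
`[0, ∞)`, and every such solution is bounded. -/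
def Plant.HasBoundedStates {n m : ℕ} (P : Plant n m) : Prop :=
  ∀ (θ : Fin m → ℝ) (x₀ : Fin n → ℝ),
    (∃ x : ℝ → Fin n → ℝ, P.IsMasterSolution θ x ∧ x 0 = x₀) ∧
    ∀ x : ℝ → Fin n → ℝ, P.IsMasterSolution θ x → x 0 = x₀ → BoundedSignal x

/-- `F = A - k cᵀ`. -/
def Plant.F {n m : ℕ} (P : Plant n m) (k : Fin n → ℝ) : Matrix (Fin n) (Fin n) ℝ :=
  P.A - vecMulVec k P.c

/-- All complex eigenvalues have negative real part. -/
def IsHurwitz {n : ℕ} (F : Matrix (Fin n) (Fin n) ℝ) : Prop :=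
  ∀ s ∈ spectrum ℂ (F.map (algebraMap ℝ ℂ)), s.re < 0

/-- The transfer function `H(s) = cᵀ (s I - F)⁻¹ b`, meaningful off the spectrum of `F`. -/
noncomputable def transferFunction {n : ℕ} (F : Matrix (Fin n) (Fin n) ℝ) (b c : Fin n → ℝ)
    (s : ℂ) : ℂ :=
  (fun i => (c i : ℂ)) ⬝ᵥ
    ((s • (1 : Matrix (Fin n) (Fin n) ℂ) - F.map (algebraMap ℝ ℂ))⁻¹ *ᵥ fun i => (b i : ℂ))

/-- Minimum phase: all (finite) zeros of `H` lie in the open left half plane; in particular `H`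
is not identically zero. To be used for Hurwitz `F`, when `H` has no pole in `Re s ≥ 0`. -/
def IsMinimumPhase {n : ℕ} (F : Matrix (Fin n) (Fin n) ℝ) (b c : Fin n → ℝ) : Prop :=
  ∀ s : ℂ, transferFunction F b c s = 0 → s.re < 0

/-- `z` is a state of the filter `z' = F z + b u` on `[0, ∞)`, with any initial value. The filter
output `H(p)[u]` is `cᵀ z`. -/
def IsFilterState {n : ℕ} (F : Matrix (Fin n) (Fin n) ℝ) (b : Fin n → ℝ)
    (u : ℝ → ℝ) (z : ℝ → Fin n → ℝ) : Prop :=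
  ∀ t : ℝ, 0 ≤ t → HasDerivWithinAt z (F *ᵥ z t + u t • b) (Ici 0) t

/-- Persistent excitation on `[0, ∞)`: measurable, bounded, and
`∫_t^{t+T} f fᵀ ≥ α I` for some `α, T > 0` and all `t ≥ 0`. -/
def PersistentlyExciting {m : ℕ} (f : ℝ → Fin m → ℝ) : Prop :=
  Measurable (fun t : Ici (0 : ℝ) => f t) ∧ BoundedSignal f ∧
  ∃ α T : ℝ, 0 < α ∧ 0 < T ∧ ∀ t : ℝ, 0 ≤ t →
    ((Matrix.of fun i j : Fin m => ∫ s in t..(t + T), f s i * f s j) -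
      α • (1 : Matrix (Fin m) (Fin m) ℝ)).PosSemidef

/-- The state signals of the closed loop: master state `x`, observer state `xhat`, parameter
estimate `θhat`, state `Ω i` of the filter producing `ω i = H(p)[φ i]`, and state `ζ` of the
filter producing `H(p)[φᵀ θhat]`. -/
structure Signals (n m : ℕ) where
  x : ℝ → Fin n → ℝ
  xhat : ℝ → Fin n → ℝ
  θhat : ℝ → Fin m → ℝ
  Ω : Fin m → ℝ → Fin n → ℝ
  ζ : ℝ → Fin n → ℝ

namespace Signals

variable {n m : ℕ}

/-- Master output `y = cᵀ x`. -/
def y (P : Plant n m) (S : Signals n m) (t : ℝ) : ℝ := P.c ⬝ᵥ S.x t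

/-- Observer output `ŷ = cᵀ x̂`. -/
def yhat (P : Plant n m) (S : Signals n m) (t : ℝ) : ℝ := P.c ⬝ᵥ S.xhat t

/-- Output error `e = y - ŷ`. -/
def e (P : Plant n m) (S : Signals n m) (t : ℝ) : ℝ := S.y P t - S.yhat P t

/-- Regressor `φ(t) = φ(y(t))`. -/
def regressor (P : Plant n m) (S : Signals n m) (t : ℝ) : Fin m → ℝ := P.φ (S.y P t)

/-- Filtered regressor `ω = H(p)[φ(t)]`. -/
def ω (P : Plant n m) (S : Signals n m) (t : ℝ) : Fin m → ℝ := fun i => P.c ⬝ᵥ S.Ω i t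

/-- The signal `H(p)[φ(t)ᵀ θhat]`. -/
def χ (P : Plant n m) (S : Signals n m) (t : ℝ) : ℝ := P.c ⬝ᵥ S.ζ t

/-- Augmented error `ê = e + H(p)[φᵀ θhat] - ωᵀ θhat`. -/
def ehat (P : Plant n m) (S : Signals n m) (t : ℝ) : ℝ :=
  S.e P t + S.χ P t - S.ω P t ⬝ᵥ S.θhat t

/-- The signals satisfy, on `[0, ∞)`, the master system, the observer, the two filter equations
and the adaptation law. -/
structure IsClosedLoop (P : Plant n m) (k : Fin n → ℝ) (γ : ℝ) (θ : Fin m → ℝ)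
    (S : Signals n m) : Prop where
  master : P.IsMasterSolution θ S.x
  observer : ∀ t : ℝ, 0 ≤ t →
    HasDerivWithinAt S.xhat
      (P.A *ᵥ S.xhat t + P.φ₀ (S.y P t) + (P.φ (S.y P t) ⬝ᵥ S.θhat t) • P.b +
        (S.y P t - S.yhat P t) • k) (Ici 0) t
  filterΩ : ∀ i : Fin m, IsFilterState (P.F k) P.b (fun t => S.regressor P t i) (S.Ω i)
  filterζ : IsFilterState (P.F k) P.b (fun t => S.regressor P t ⬝ᵥ S.θhat t) S.ζ
  adaptation : ∀ t : ℝ, 0 ≤ t →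
    HasDerivWithinAt S.θhat ((γ * S.ehat P t) • S.ω P t) (Ici 0) t

/-- All signals of the loop are bounded on `[0, ∞)`. -/
structure AllBounded (P : Plant n m) (S : Signals n m) : Prop where
  x : BoundedSignal S.x
  xhat : BoundedSignal S.xhat
  θhat : BoundedSignal S.θhat
  Ω : ∀ i : Fin m, BoundedSignal (S.Ω i)
  ζ : BoundedSignal S.ζ
  y : BoundedSignal (S.y P)
  yhat : BoundedSignal (S.yhat P)
  e : BoundedSignal (S.e P)
  φ₀ : BoundedSignal (fun t => P.φ₀ (S.y P t))
  regressor : BoundedSignal (S.regressor P)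
  ω : BoundedSignal (S.ω P)
  χ : BoundedSignal (S.χ P)
  ehat : BoundedSignal (S.ehat P)

end Signals

/-!
Since `F` is Hurwitz, `ê = ωᵀ (θ - θhat) + cᵀ δ` with `δ' = F δ` exponentially decaying, so the
adaptation law is a gradient law for `θ - θhat` up to a vanishing disturbance: `|θ - θhat|²` plus
the tail of the disturbance energy is nonincreasing, hence converges, and Barbalat's lemma gives
`ωᵀ (θ - θhat) → 0`, `ê → 0` and `θhat' → 0`. Filtering `φᵀ (θ - θhat)` by `H` gives `y - yhat`,
which differs from `ωᵀ (θ - θhat)` by a term that vanishes because `θhat' → 0` (swapping lemma);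
hence `y - yhat → 0`.

If `H` is minimum phase, write `u = φᵀ (θ - θhat) = D(d/dt) ξ` with `D` the characteristic
polynomial of `F`, so that `y - yhat = N(d/dt) ξ` up to a decaying term, `N` being the numerator of
`H`. The roots of the Hurwitz polynomial `N` are divided out of `N(d/dt) ξ → 0` to give `ξ → 0`,
and Barbalat's lemma brings back all derivatives up to `u → 0`. As `θ - θhat` varies ever more
slowly, `φᵀ (θ - θhat) → 0` and persistent excitation force `θ - θhat → 0`.
-/

section ScalarFilter

theorem hasDerivWithinAt_exp_mul {l ν : ℂ} {w g : ℝ → ℂ} {s : Set ℝ} {t : ℝ}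
    (hw : HasDerivWithinAt w (l * w t + g t) s t) :
    HasDerivWithinAt (fun r : ℝ => Complex.exp (ν * r) * w r)
      ((l + ν) * (Complex.exp (ν * t) * w t) + Complex.exp (ν * t) * g t) s t := by
  have hν : HasDerivAt (fun r : ℝ => ν * (r : ℂ)) ν t := by
    simpa using (hasDerivAt_id t).ofReal_comp.const_mul ν
  refine (hν.cexp.hasDerivWithinAt.mul hw).congr_deriv ?_
  ring

theorem norm_exp_mul_ofReal (ν : ℂ) (t : ℝ) :
    ‖Complex.exp (ν * t)‖ = Real.exp (ν.re * t) := by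
  simp [Complex.norm_exp]

theorem norm_le_of_hasDerivWithinAt_mul_add {l : ℂ} (hl : l.re < 0) {w g : ℝ → ℂ} {T M : ℝ}
    (hw : ∀ t : ℝ, T ≤ t → HasDerivWithinAt w (l * w t + g t) (Ici T) t)
    (hg : ∀ t : ℝ, T ≤ t → ‖g t‖ ≤ M) {t : ℝ} (ht : T ≤ t) :
    ‖w t‖ ≤ Real.exp (l.re * (t - T)) * ‖w T‖ + M / -l.re := by
  have hM : 0 ≤ M := (norm_nonneg _).trans (hg T le_rfl)
  have hl' : 0 < -l.re := neg_pos.2 hl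
  set W : ℝ → ℂ := fun s => Complex.exp (-l * s) * w s
  have hnorm : ∀ s, ‖W s‖ = Real.exp (-l.re * s) * ‖w s‖ := fun s => by
    rw [norm_mul, norm_exp_mul_ofReal, Complex.neg_re]
  have hW : ∀ s, T ≤ s → HasDerivWithinAt W (Complex.exp (-l * s) * g s) (Ici T) s := fun s hs =>
    (hasDerivWithinAt_exp_mul (hw s hs)).congr_deriv (by simp)
  have hB : ∀ s, HasDerivAt (fun s => ‖W T‖ + M / -l.re * Real.exp (-l.re * s))
      (M * Real.exp (-l.re * s)) s := fun s => by
    refine ((((hasDerivAt_id s).const_mul (-l.re)).exp.const_mul (M / -l.re)).const_add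
      ‖W T‖).congr_deriv ?_
    simp only [id_eq]
    field_simp [hl.ne]
  have hWt : ‖W t‖ ≤ ‖W T‖ + M / -l.re * Real.exp (-l.re * t) :=
    image_norm_le_of_norm_deriv_right_le_deriv_boundary
      (fun s hs => ((hW s hs.1).continuousWithinAt).mono fun r hr => hr.1)
      (fun s hs => (hW s hs.1).mono fun r hr => hs.1.trans hr)
      (by simpa using mul_nonneg (div_nonneg hM hl'.le) (Real.exp_pos _).le) hB
      (fun s hs => by
        rw [norm_mul, norm_exp_mul_ofReal, Complex.neg_re, mul_comm]
        gcongr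
        exact hg s hs.1)
      ⟨ht, le_rfl⟩
  rw [hnorm, hnorm] at hWt
  calc ‖w t‖ = Real.exp (l.re * t) * (Real.exp (-l.re * t) * ‖w t‖) := by
        rw [← mul_assoc, ← Real.exp_add]
        simp
    _ ≤ Real.exp (l.re * t) *
          (Real.exp (-l.re * T) * ‖w T‖ + M / -l.re * Real.exp (-l.re * t)) := by gcongr
    _ = Real.exp (l.re * t + -l.re * T) * ‖w T‖ +
          M / -l.re * Real.exp (l.re * t + -l.re * t) := by
        rw [Real.exp_add, Real.exp_add]
        ring
    _ = Real.exp (l.re * (t - T)) * ‖w T‖ + M / -l.re := by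
        rw [show l.re * t + -l.re * T = l.re * (t - T) by ring,
          show l.re * t + -l.re * t = 0 by ring, Real.exp_zero, mul_one]

theorem BoundedSignal.of_hasDerivWithinAt_mul_add {l : ℂ} (hl : l.re < 0) {w g : ℝ → ℂ}
    (hw : ∀ t : ℝ, 0 ≤ t → HasDerivWithinAt w (l * w t + g t) (Ici 0) t)
    (hg : BoundedSignal g) : BoundedSignal w := by
  obtain ⟨M, hM⟩ := hg
  refine ⟨‖w 0‖ + M / -l.re, fun t ht => ?_⟩
  refine (norm_le_of_hasDerivWithinAt_mul_add hl hw hM ht).trans ?_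
  gcongr
  refine mul_le_of_le_one_left (norm_nonneg _) (Real.exp_le_one_iff.2 ?_)
  nlinarith

theorem tendsto_zero_of_hasDerivWithinAt_mul_add {l : ℂ} (hl : l.re < 0) {w g : ℝ → ℂ}
    (hw : ∀ t : ℝ, 0 ≤ t → HasDerivWithinAt w (l * w t + g t) (Ici 0) t)
    (hg : Tendsto g atTop (𝓝 0)) : Tendsto w atTop (𝓝 0) := by
  rw [NormedAddGroup.tendsto_nhds_zero] at hg ⊢
  intro ε hε
  have hl' : 0 < -l.re := neg_pos.2 hl
  obtain ⟨T, hT⟩ := eventually_atTop.1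
    ((hg (-l.re * (ε / 2)) (by positivity)).and (eventually_ge_atTop 0))
  have hT0 : 0 ≤ T := (hT T le_rfl).2
  have hbound : ∀ t, T ≤ t → ‖w t‖ ≤ Real.exp (l.re * (t - T)) * ‖w T‖ + ε / 2 := fun t ht => by
    have h := norm_le_of_hasDerivWithinAt_mul_add hl
      (fun s hs => (hw s (hT0.trans hs)).mono (Ici_subset_Ici.2 hT0))
      (fun s hs => (hT s hs).1.le) ht
    rwa [mul_div_cancel_left₀ _ hl'.ne'] at h
  have hlim : Tendsto (fun t : ℝ => Real.exp (l.re * (t - T)) * ‖w T‖) atTop (𝓝 0) := by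
    rw [← zero_mul ‖w T‖]
    exact (Real.tendsto_exp_atBot.comp ((tendsto_atTop_add_const_right _ (-T)
      tendsto_id).const_mul_atTop_of_neg hl)).mul_const _
  filter_upwards [hlim.eventually (gt_mem_nhds (half_pos hε)), eventually_ge_atTop T]
    with t hlt ht
  linarith [hbound t ht]

/-- A signal that decays at least exponentially on `[0, ∞)`. -/
def ExpDecaying {E : Type*} [Norm E] (f : ℝ → E) : Prop :=
  ∃ μ > 0, ∃ M : ℝ, ∀ t : ℝ, 0 ≤ t → ‖f t‖ ≤ M * Real.exp (-μ * t)

theorem expDecaying_iff_exists_boundedSignal {f : ℝ → ℂ} :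
    ExpDecaying f ↔ ∃ μ : ℝ, 0 < μ ∧ BoundedSignal fun t : ℝ => Complex.exp (μ * t) * f t := by
  refine exists_congr fun μ => and_congr_right fun _ => exists_congr fun M =>
    forall₂_congr fun t _ => ?_
  rw [norm_mul, norm_exp_mul_ofReal, Complex.ofReal_re, neg_mul, Real.exp_neg, ← div_eq_mul_inv,
    le_div_iff₀' (Real.exp_pos _)]

theorem BoundedSignal.exp_mul_of_le {f : ℝ → ℂ} {μ ν : ℝ}
    (hf : BoundedSignal fun t : ℝ => Complex.exp (μ * t) * f t) (hν : ν ≤ μ) :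
    BoundedSignal fun t : ℝ => Complex.exp (ν * t) * f t := by
  obtain ⟨M, hM⟩ := hf
  refine ⟨M, fun t ht => le_trans ?_ (hM t ht)⟩
  simp only [norm_mul, norm_exp_mul_ofReal, Complex.ofReal_re]
  gcongr

theorem ExpDecaying.of_hasDerivWithinAt_mul_add {l : ℂ} (hl : l.re < 0) {w g : ℝ → ℂ}
    (hw : ∀ t : ℝ, 0 ≤ t → HasDerivWithinAt w (l * w t + g t) (Ici 0) t)
    (hg : ExpDecaying g) : ExpDecaying w := by
  obtain ⟨μ, hμ, hb⟩ := expDecaying_iff_exists_boundedSignal.1 hg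
  obtain ⟨ν, hν, hνmin⟩ := exists_between (lt_min hμ (neg_pos.2 hl))
  obtain ⟨hνμ, hνl⟩ := lt_min_iff.1 hνmin
  refine expDecaying_iff_exists_boundedSignal.2 ⟨ν, hν, ?_⟩
  exact BoundedSignal.of_hasDerivWithinAt_mul_add (l := l + ν)
    (by simpa using by linarith)
    (fun t ht => hasDerivWithinAt_exp_mul (hw t ht)) (hb.exp_mul_of_le hνμ.le)

end ScalarFilter

section SignalClass

/-- A class of scalar signals is filter stable when it contains every solution on `[0, ∞)` of a
stable first order equation `w' = l w + g` whose input `g` lies in the class. -/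
def IsFilterStable (S : Submodule ℂ (ℝ → ℂ)) : Prop :=
  ∀ ⦃l : ℂ⦄ ⦃w g : ℝ → ℂ⦄, l.re < 0 →
    (∀ t : ℝ, 0 ≤ t → HasDerivWithinAt w (l * w t + g t) (Ici 0) t) → g ∈ S → w ∈ S

/-- The scalar signals that are bounded on `[0, ∞)`. -/
def boundedSignals : Submodule ℂ (ℝ → ℂ) where
  carrier := {f | BoundedSignal f}
  zero_mem' := ⟨0, by simp⟩
  add_mem' := fun ⟨M, hM⟩ ⟨N, hN⟩ =>
    ⟨M + N, fun t ht => (norm_add_le _ _).trans (add_le_add (hM t ht) (hN t ht))⟩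
  smul_mem' := fun a _ ⟨M, hM⟩ =>
    ⟨‖a‖ * M, fun t ht =>
      (norm_smul_le _ _).trans (mul_le_mul_of_nonneg_left (hM t ht) (norm_nonneg a))⟩

/-- The scalar signals that decay exponentially on `[0, ∞)`. -/
def expDecayingSignals : Submodule ℂ (ℝ → ℂ) where
  carrier := {f | ExpDecaying f}
  zero_mem' := ⟨1, one_pos, 0, by simp⟩
  add_mem' := fun {f g} hf hg => by
    obtain ⟨μ, hμ, hf⟩ := expDecaying_iff_exists_boundedSignal.1 hf
    obtain ⟨ν, hν, hg⟩ := expDecaying_iff_exists_boundedSignal.1 hg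
    refine expDecaying_iff_exists_boundedSignal.2 ⟨min μ ν, lt_min hμ hν, ?_⟩
    have h : BoundedSignal _ := boundedSignals.add_mem (hf.exp_mul_of_le (min_le_left μ ν))
      (hg.exp_mul_of_le (min_le_right μ ν))
    simpa only [Pi.add_def, mul_add] using h
  smul_mem' := fun a f hf => by
    obtain ⟨μ, hμ, hf⟩ := expDecaying_iff_exists_boundedSignal.1 hf
    refine expDecaying_iff_exists_boundedSignal.2 ⟨μ, hμ, ?_⟩
    have h : BoundedSignal _ := boundedSignals.smul_mem a hf
    simpa only [Pi.smul_def, mul_smul_comm] using h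

/-- The scalar signals that tend to zero at infinity. -/
def vanishingSignals : Submodule ℂ (ℝ → ℂ) where
  carrier := {f | Tendsto f atTop (𝓝 0)}
  zero_mem' := tendsto_const_nhds
  add_mem' := fun {f g} (hf : Tendsto f atTop (𝓝 0)) (hg : Tendsto g atTop (𝓝 0)) =>
    by simpa [Pi.add_def] using hf.add hg
  smul_mem' := fun a f (hf : Tendsto f atTop (𝓝 0)) =>
    by simpa [Pi.smul_def] using hf.const_smul a

theorem isFilterStable_boundedSignals : IsFilterStable boundedSignals :=
  fun _ _ _ hl hw hg => BoundedSignal.of_hasDerivWithinAt_mul_add hl hw hg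

theorem isFilterStable_expDecayingSignals : IsFilterStable expDecayingSignals :=
  fun _ _ _ hl hw hg => ExpDecaying.of_hasDerivWithinAt_mul_add hl hw hg

theorem isFilterStable_vanishingSignals : IsFilterStable vanishingSignals :=
  fun _ _ _ hl hw hg => tendsto_zero_of_hasDerivWithinAt_mul_add hl hw hg

end SignalClass

theorem hasDerivWithinAt_dotProduct {ι 𝔸 : Type*} [Fintype ι] [NormedCommRing 𝔸]
    [NormedAlgebra ℝ 𝔸] {f g : ℝ → ι → 𝔸} {f' g' : ι → 𝔸} {s : Set ℝ} {t : ℝ}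
    (hf : HasDerivWithinAt f f' s t) (hg : HasDerivWithinAt g g' s t) :
    HasDerivWithinAt (fun t => f t ⬝ᵥ g t) (f' ⬝ᵥ g t + f t ⬝ᵥ g') s t := by
  rw [hasDerivWithinAt_pi] at hf hg
  refine (HasDerivWithinAt.fun_sum (u := Finset.univ)
    fun i _ => (hf i).mul (hg i)).congr_deriv ?_
  simp only [dotProduct, Finset.sum_add_distrib]

section PolynomialOutput

open Polynomial

variable {ι : Type*} [Fintype ι] [DecidableEq ι] {F : Matrix ι ι ℂ} {c : ι → ℂ}
  {z f : ℝ → ι → ℂ} {S : Submodule ℂ (ℝ → ℂ)}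

/-- A complex polynomial is Hurwitz when its roots lie in the open left half-plane; the zero
polynomial is not. -/
def IsHurwitzPolynomial (p : ℂ[X]) : Prop :=
  ∀ s : ℂ, p.IsRoot s → s.re < 0

theorem IsHurwitzPolynomial.ne_zero {p : ℂ[X]} (hp : IsHurwitzPolynomial p) : p ≠ 0 := by
  rintro rfl
  exact absurd (hp 0 (by simp)) (by simp)

@[elab_as_elim]
theorem IsHurwitzPolynomial.induction_on {motive : (p : ℂ[X]) → IsHurwitzPolynomial p → Prop}
    (C : ∀ a : ℂ, a ≠ 0 → ∀ h : IsHurwitzPolynomial (C a), motive (C a) h)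
    (X_sub_C_mul : ∀ (l : ℂ) (r : ℂ[X]), l.re < 0 → ∀ hr : IsHurwitzPolynomial r, motive r hr →
      ∀ h : IsHurwitzPolynomial ((X - Polynomial.C l) * r), motive _ h)
    (p : ℂ[X]) (hp : IsHurwitzPolynomial p) : motive p hp := by
  induction hk : p.natDegree generalizing p with
  | zero =>
    obtain ⟨a, rfl⟩ := natDegree_eq_zero.1 hk
    exact C a (C_ne_zero.1 hp.ne_zero) hp
  | succ k ih =>
    obtain ⟨l, hl⟩ := IsAlgClosed.exists_root p fun h => by
      simp [natDegree_eq_of_degree_eq_some h] at hk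
    obtain ⟨r, rfl⟩ := dvd_iff_isRoot.2 hl
    have hr : IsHurwitzPolynomial r := fun s hs => hp s (hs.dvd (dvd_mul_left r _))
    rw [natDegree_mul (X_sub_C_ne_zero l) hr.ne_zero, natDegree_X_sub_C] at hk
    exact X_sub_C_mul l r (hp l hl) hr (ih r hr (by omega)) hp

theorem natDegree_mul_X_sub_C_add_le {q r : ℂ[X]} {l : ℂ} {d : ℕ} (hr : r ≠ 0)
    (hdeg : q.natDegree + ((X - C l) * r).natDegree ≤ d) :
    q.natDegree < d ∧ (q * (X - C l)).natDegree + r.natDegree ≤ d := by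
  have hqX : (q * (X - C l)).natDegree ≤ q.natDegree + 1 :=
    natDegree_mul_le.trans (by rw [natDegree_X_sub_C])
  rw [natDegree_mul (X_sub_C_ne_zero l) hr, natDegree_X_sub_C] at hdeg
  omega

theorem map_X_mul_eq {M : Type*} [AddCommGroup M] [Module ℂ M] (Φ : ℂ[X] →ₗ[ℂ] M) (l : ℂ)
    (q : ℂ[X]) : Φ (X * q) = l • Φ q + Φ (q * (X - C l)) := by
  rw [← map_smul, ← map_add, smul_eq_C_mul]
  ring_nf

theorem IsFilterStable.mem_of_mul_mem (hS : IsFilterStable S) {Φ : ℂ[X] →ₗ[ℂ] ℝ → ℂ}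
    {r : ℂ[X] → ℝ → ℂ} {d : ℕ}
    (hΦ : ∀ q : ℂ[X], q.natDegree < d → ∀ t : ℝ, 0 ≤ t →
      HasDerivWithinAt (Φ q) (Φ (X * q) t + r q t) (Ici 0) t)
    (hr : ∀ q : ℂ[X], q.natDegree < d → r q ∈ S) {p : ℂ[X]} (hp : IsHurwitzPolynomial p)
    {q : ℂ[X]} (hdeg : q.natDegree + p.natDegree ≤ d) (hqp : Φ (q * p) ∈ S) : Φ q ∈ S := by
  induction p, hp using IsHurwitzPolynomial.induction_on generalizing q with
  | C a ha =>
    rw [mul_comm, ← smul_eq_C_mul, map_smul] at hqp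
    exact (S.smul_mem_iff ha).1 hqp
  | X_sub_C_mul l p hl hp ih =>
    obtain ⟨hq, hqX⟩ := natDegree_mul_X_sub_C_add_le hp.ne_zero hdeg
    have hg : Φ (q * (X - C l)) ∈ S := ih hqX (by rwa [mul_assoc])
    refine hS hl (fun t ht => (hΦ q hq t ht).congr_deriv ?_) (S.add_mem hg (hr q hq))
    simp only [map_X_mul_eq Φ l, Pi.add_apply, Pi.smul_apply, smul_eq_mul, add_assoc]

/-- The scalar signal `cᵀ q(F) z`, as a linear function of the polynomial `q`. -/
noncomputable def polyOutput (F : Matrix ι ι ℂ) (c : ι → ℂ) (z : ℝ → ι → ℂ) :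
    ℂ[X] →ₗ[ℂ] ℝ → ℂ where
  toFun q t := c ⬝ᵥ (aeval F q *ᵥ z t)
  map_add' p q := by
    ext t
    simp only [map_add, add_mulVec, dotProduct_add, Pi.add_apply]
  map_smul' a q := by
    ext t
    simp only [map_smul, smul_mulVec, dotProduct_smul, Pi.smul_apply, RingHom.id_apply]

theorem polyOutput_apply (q : ℂ[X]) (t : ℝ) :
    polyOutput F c z q t = c ⬝ᵥ (aeval F q *ᵥ z t) := rfl

theorem polyOutput_eq_vecMul (q : ℂ[X]) :
    polyOutput F c z q = fun t => (c ᵥ* aeval F q) ⬝ᵥ z t :=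
  funext fun _ => dotProduct_mulVec _ _ _

theorem hasDerivWithinAt_polyOutput {s : Set ℝ} {t : ℝ}
    (hz : HasDerivWithinAt z (F *ᵥ z t + f t) s t) (q : ℂ[X]) :
    HasDerivWithinAt (polyOutput F c z q)
      (polyOutput F c z (X * q) t + polyOutput F c f q t) s t := by
  rw [polyOutput_eq_vecMul q]
  refine (hasDerivWithinAt_dotProduct (hasDerivWithinAt_const t s (c ᵥ* aeval F q))
    hz).congr_deriv ?_
  rw [zero_dotProduct, zero_add, dotProduct_add, ← dotProduct_mulVec, mulVec_mulVec,
    ← dotProduct_mulVec, polyOutput_apply, polyOutput_apply, mul_comm X q, map_mul, aeval_X]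

theorem IsFilterStable.dotProduct_mem (hS : IsFilterStable S)
    (hF : IsHurwitzPolynomial F.charpoly)
    (hz : ∀ t : ℝ, 0 ≤ t → HasDerivWithinAt z (F *ᵥ z t + f t) (Ici 0) t)
    (hf : ∀ i, (fun t => f t i) ∈ S) (c : ι → ℂ) : (fun t => c ⬝ᵥ z t) ∈ S := by
  have hfq : ∀ q : ℂ[X], polyOutput F c f q ∈ S := fun q => by
    have h : polyOutput F c f q = ∑ i, (c ᵥ* aeval F q) i • fun t => f t i := by
      ext t
      simp [polyOutput_eq_vecMul, dotProduct, Finset.sum_apply]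
    rw [h]
    exact S.sum_mem fun i _ => S.smul_mem _ (hf i)
  have h := hS.mem_of_mul_mem (q := 1) (fun q _ t ht => hasDerivWithinAt_polyOutput (hz t ht) q)
    (fun q _ => hfq q) hF le_rfl (by
    have h0 : polyOutput F c z (1 * F.charpoly) = 0 := by
      ext t
      simp [polyOutput_apply, aeval_self_charpoly]
    exact h0 ▸ S.zero_mem)
  simpa only [polyOutput_eq_vecMul, map_one, vecMul_one] using h

end PolynomialOutput

section HurwitzMatrix

variable {n : ℕ} {F : Matrix (Fin n) (Fin n) ℝ} {z f : ℝ → Fin n → ℝ}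

theorem IsHurwitz.isHurwitzPolynomial_charpoly (hF : IsHurwitz F) :
    IsHurwitzPolynomial (F.map (algebraMap ℝ ℂ)).charpoly :=
  fun s hs => hF s (mem_spectrum_of_isRoot_charpoly hs)

theorem hasDerivWithinAt_ofReal_mulVec_add {s : Set ℝ} {t : ℝ}
    (hz : HasDerivWithinAt z (F *ᵥ z t + f t) s t) :
    HasDerivWithinAt (fun t i => (z t i : ℂ))
      (F.map (algebraMap ℝ ℂ) *ᵥ (fun i => (z t i : ℂ)) + fun i => (f t i : ℂ)) s t := by
  refine hasDerivWithinAt_pi.2 fun i =>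
    ((hasDerivWithinAt_pi.1 hz) i).ofReal_comp.congr_deriv ?_
  simp [mulVec, dotProduct]

theorem ofReal_dotProduct {ι : Type*} [Fintype ι] (v w : ι → ℝ) :
    ((v ⬝ᵥ w : ℝ) : ℂ) = (fun i => (v i : ℂ)) ⬝ᵥ fun i => (w i : ℂ) := by
  simp [dotProduct]

theorem IsFilterStable.ofReal_dotProduct_mem {S : Submodule ℂ (ℝ → ℂ)} (hS : IsFilterStable S)
    (hF : IsHurwitz F)
    (hz : ∀ t : ℝ, 0 ≤ t → HasDerivWithinAt z (F *ᵥ z t + f t) (Ici 0) t)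
    (hf : ∀ i, (fun t => (f t i : ℂ)) ∈ S) (c : Fin n → ℝ) :
    (fun t => ((c ⬝ᵥ z t : ℝ) : ℂ)) ∈ S := by
  simp only [ofReal_dotProduct]
  exact hS.dotProduct_mem hF.isHurwitzPolynomial_charpoly
    (fun t ht => hasDerivWithinAt_ofReal_mulVec_add (hz t ht)) hf _

theorem boundedSignal_pi {ι E : Type*} [Fintype ι] [SeminormedAddCommGroup E] {f : ℝ → ι → E} :
    BoundedSignal f ↔ ∀ i, BoundedSignal fun t => f t i := by
  refine ⟨fun ⟨M, hM⟩ i => ⟨M, fun t ht => (norm_le_pi_norm (f t) i).trans (hM t ht)⟩,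
    fun hf => ?_⟩
  choose M hM using hf
  exact ⟨‖M‖, fun t ht => (pi_norm_le_iff_of_nonneg (norm_nonneg _)).2 fun i =>
    (hM i t ht).trans ((le_abs_self _).trans (norm_le_pi_norm M i))⟩

theorem IsHurwitz.boundedSignal (hF : IsHurwitz F)
    (hz : ∀ t : ℝ, 0 ≤ t → HasDerivWithinAt z (F *ᵥ z t + f t) (Ici 0) t)
    (hf : BoundedSignal f) : BoundedSignal z := by
  refine boundedSignal_pi.2 fun i => ?_
  have h : BoundedSignal _ := isFilterStable_boundedSignals.ofReal_dotProduct_mem hF hz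
    (fun j => show BoundedSignal _ by simpa [BoundedSignal] using boundedSignal_pi.1 hf j)
    (Pi.single i 1)
  simpa [BoundedSignal] using h

theorem IsHurwitz.expDecaying_dotProduct (hF : IsHurwitz F)
    (hz : ∀ t : ℝ, 0 ≤ t → HasDerivWithinAt z (F *ᵥ z t) (Ici 0) t) (c : Fin n → ℝ) :
    ExpDecaying fun t => c ⬝ᵥ z t := by
  have h : ExpDecaying _ := isFilterStable_expDecayingSignals.ofReal_dotProduct_mem (f := 0) hF
    (by simpa using hz) (fun i => by simpa [Pi.zero_def] using zero_mem expDecayingSignals) c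
  simpa [ExpDecaying] using h

theorem IsHurwitz.tendsto_dotProduct (hF : IsHurwitz F)
    (hz : ∀ t : ℝ, 0 ≤ t → HasDerivWithinAt z (F *ᵥ z t + f t) (Ici 0) t)
    (hf : Tendsto f atTop (𝓝 0)) (c : Fin n → ℝ) :
    Tendsto (fun t => c ⬝ᵥ z t) atTop (𝓝 0) := by
  rw [← tendsto_ofReal_iff, Complex.ofReal_zero]
  refine isFilterStable_vanishingSignals.ofReal_dotProduct_mem hF hz (fun i => ?_) c
  exact (tendsto_ofReal_iff (x := 0)).2 (tendsto_pi_nhds.1 hf i)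

end HurwitzMatrix

section BoundedSignal

variable {E E' : Type*} [NormedAddCommGroup E] [NormedAddCommGroup E']

theorem BoundedSignal.prodMk {f : ℝ → E} {g : ℝ → E'} (hf : BoundedSignal f)
    (hg : BoundedSignal g) : BoundedSignal fun t => (f t, g t) := by
  obtain ⟨M, hM⟩ := hf
  obtain ⟨N, hN⟩ := hg
  exact ⟨max M N, fun t ht => by simpa [Prod.norm_mk] using max_le_max (hM t ht) (hN t ht)⟩

theorem BoundedSignal.comp [ProperSpace E] {f : ℝ → E} {Φ : E → E'} (hf : BoundedSignal f)
    (hΦ : Continuous Φ) : BoundedSignal fun t => Φ (f t) := by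
  obtain ⟨M, hM⟩ := hf
  obtain ⟨C, hC⟩ := (isCompact_closedBall (0 : E) M).exists_bound_of_continuousOn
    hΦ.continuousOn
  exact ⟨C, fun t ht => hC _ (by simpa using hM t ht)⟩

theorem BoundedSignal.add {f g : ℝ → E} (hf : BoundedSignal f) (hg : BoundedSignal g) :
    BoundedSignal fun t => f t + g t := by
  obtain ⟨M, hM⟩ := hf
  obtain ⟨N, hN⟩ := hg
  exact ⟨M + N, fun t ht => norm_add_le_of_le (hM t ht) (hN t ht)⟩

theorem BoundedSignal.sub {f g : ℝ → E} (hf : BoundedSignal f) (hg : BoundedSignal g) :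
    BoundedSignal fun t => f t - g t := by
  obtain ⟨M, hM⟩ := hf
  obtain ⟨N, hN⟩ := hg
  exact ⟨M + N, fun t ht => norm_sub_le_of_le (hM t ht) (hN t ht)⟩

theorem BoundedSignal.const_dotProduct {ι : Type*} [Fintype ι] (c : ι → ℝ) {g : ℝ → ι → ℝ}
    (hg : BoundedSignal g) : BoundedSignal fun t => c ⬝ᵥ g t :=
  hg.comp (Φ := fun v => c ⬝ᵥ v) (by fun_prop)

theorem BoundedSignal.dotProduct {ι : Type*} [Fintype ι] {f g : ℝ → ι → ℝ}
    (hf : BoundedSignal f) (hg : BoundedSignal g) : BoundedSignal fun t => f t ⬝ᵥ g t :=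
  (hf.prodMk hg).comp (Φ := fun q : (ι → ℝ) × (ι → ℝ) => q.1 ⬝ᵥ q.2) (by fun_prop)

theorem BoundedSignal.tendsto_smul_zero [NormedSpace ℝ E] {f : ℝ → ℝ} {g : ℝ → E}
    (hg : BoundedSignal g) (hf : Tendsto f atTop (𝓝 0)) :
    Tendsto (fun t => f t • g t) atTop (𝓝 0) := by
  obtain ⟨M, hM⟩ := hg
  refine hf.zero_smul_isBoundedUnder_le ⟨M, eventually_map.2 ?_⟩
  filter_upwards [eventually_ge_atTop 0] with t ht using hM t ht

/-- A signal that is bounded and uniformly continuous on `[0, ∞)`, the regularity that Barbalat's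
lemma asks of a derivative. -/
structure BddUniformContinuous (f : ℝ → E) : Prop where
  bounded : BoundedSignal f
  uniform : UniformContinuousOn f (Ici 0)

namespace BddUniformContinuous

theorem of_hasDerivWithinAt [NormedSpace ℝ E] {f f' : ℝ → E} (hf : BoundedSignal f)
    (hd : ∀ t : ℝ, 0 ≤ t → HasDerivWithinAt f (f' t) (Ici 0) t) (hf' : BoundedSignal f') :
    BddUniformContinuous f := by
  obtain ⟨C, hC⟩ := hf'
  refine ⟨hf, LipschitzOnWith.uniformContinuousOn (K := C.toNNReal)
    ((convex_Ici 0).lipschitzOnWith_of_nnnorm_hasDerivWithin_le hd fun t ht => ?_)⟩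
  exact_mod_cast (hC t ht).trans (Real.le_coe_toNNReal C)

theorem prodMk {f : ℝ → E} {g : ℝ → E'} (hf : BddUniformContinuous f)
    (hg : BddUniformContinuous g) : BddUniformContinuous fun t => (f t, g t) :=
  ⟨hf.bounded.prodMk hg.bounded, uniformContinuousOn_iff_restrict.2
    ((uniformContinuousOn_iff_restrict.1 hf.uniform).prodMk
      (uniformContinuousOn_iff_restrict.1 hg.uniform))⟩

theorem pi {ι : Type*} [Fintype ι] {f : ι → ℝ → E}
    (hf : ∀ i, BddUniformContinuous (f i)) : BddUniformContinuous fun t i => f i t :=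
  ⟨boundedSignal_pi.2 fun i => (hf i).bounded, uniformContinuousOn_iff_restrict.2
    (uniformContinuous_pi.2 fun i => uniformContinuousOn_iff_restrict.1 (hf i).uniform)⟩

theorem comp [ProperSpace E] {f : ℝ → E} {Φ : E → E'} (hf : BddUniformContinuous f)
    (hΦ : Continuous Φ) : BddUniformContinuous fun t => Φ (f t) := by
  obtain ⟨M, hM⟩ := hf.bounded
  exact ⟨hf.bounded.comp hΦ, ((isCompact_closedBall (0 : E) M).uniformContinuousOn_of_continuous
    hΦ.continuousOn).comp hf.uniform fun t ht => by simpa using hM t ht⟩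

theorem const_dotProduct {ι : Type*} [Fintype ι] (c : ι → ℝ) {g : ℝ → ι → ℝ}
    (hg : BddUniformContinuous g) : BddUniformContinuous fun t => c ⬝ᵥ g t :=
  hg.comp (Φ := fun v => c ⬝ᵥ v) (by fun_prop)

theorem dotProduct {ι : Type*} [Fintype ι] {f g : ℝ → ι → ℝ} (hf : BddUniformContinuous f)
    (hg : BddUniformContinuous g) : BddUniformContinuous fun t => f t ⬝ᵥ g t :=
  (hf.prodMk hg).comp (Φ := fun q : (ι → ℝ) × (ι → ℝ) => q.1 ⬝ᵥ q.2) (by fun_prop)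

end BddUniformContinuous

end BoundedSignal

section Barbalat

variable {E : Type*} [NormedAddCommGroup E] [NormedSpace ℝ E] {G g : ℝ → E}

theorem norm_sub_sub_smul_le_of_hasDerivWithinAt {t r C : ℝ} (hr : 0 ≤ r)
    (hG : ∀ s ∈ Icc t (t + r), HasDerivWithinAt G (g s) (Icc t (t + r)) s)
    (hC : ∀ s ∈ Icc t (t + r), ‖g s - g t‖ ≤ C) : ‖G (t + r) - G t - r • g t‖ ≤ C * r := by
  have h := (convex_Icc t (t + r)).norm_image_sub_le_of_norm_hasDerivWithin_le
    (f := fun s => G s - s • g t) (f' := fun s => g s - g t)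
    (fun s hs => ((hG s hs).fun_sub
      ((hasDerivWithinAt_id s _).smul_const (g t))).congr_deriv (by simp))
    hC (left_mem_Icc.2 (by linarith)) (right_mem_Icc.2 (by linarith))
  have hsub : G (t + r) - G t - r • g t = G (t + r) - (t + r) • g t - (G t - t • g t) := by
    rw [add_smul]
    abel
  rw [hsub]
  simpa [abs_of_nonneg hr] using h

theorem tendsto_deriv_zero_of_tendsto {l : E}
    (hG : ∀ t : ℝ, 0 ≤ t → HasDerivWithinAt G (g t) (Ici 0) t)
    (hg : UniformContinuousOn g (Ici 0)) (hl : Tendsto G atTop (𝓝 l)) :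
    Tendsto g atTop (𝓝 0) := by
  rw [NormedAddGroup.tendsto_nhds_zero]
  intro ε hε
  obtain ⟨δ, hδ, hclose⟩ := Metric.uniformContinuousOn_iff.1 hg (ε / 2) (half_pos hε)
  set r := δ / 2 with hrδ
  have hr : 0 < r := half_pos hδ
  have hdiff : Tendsto (fun t => G (t + r) - G t) atTop (𝓝 0) := by
    simpa using (hl.comp (tendsto_atTop_add_const_right _ r tendsto_id)).sub hl
  rw [NormedAddGroup.tendsto_nhds_zero] at hdiff
  filter_upwards [hdiff (r * (ε / 2)) (by positivity), eventually_ge_atTop 0] with t hsmall ht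
  have hlin : ‖G (t + r) - G t - r • g t‖ ≤ ε / 2 * r := by
    refine norm_sub_sub_smul_le_of_hasDerivWithinAt hr.le
      (fun s hs => (hG s (ht.trans hs.1)).mono fun u hu => ht.trans hu.1) fun s hs => ?_
    rw [← dist_eq_norm]
    refine (hclose s (ht.trans hs.1) t ht ?_).le
    rw [Real.dist_eq, abs_of_nonneg (by linarith [hs.1])]
    linarith [hs.2]
  have hrg : r * ‖g t‖ ≤ ‖G (t + r) - G t‖ + ‖G (t + r) - G t - r • g t‖ := by
    have h := norm_sub_le (G (t + r) - G t) (G (t + r) - G t - r • g t)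
    rwa [sub_sub_cancel, norm_smul, Real.norm_of_nonneg hr.le] at h
  exact lt_of_mul_lt_mul_left (by linarith : r * ‖g t‖ < r * ε) hr.le

end Barbalat

theorem IsFilterState.bddUniformContinuous {n : ℕ} {F : Matrix (Fin n) (Fin n) ℝ}
    {b : Fin n → ℝ} (hF : IsHurwitz F) {u : ℝ → ℝ} {z : ℝ → Fin n → ℝ}
    (hz : IsFilterState F b u z) (hu : BoundedSignal u) : BddUniformContinuous z := by
  have hzb : BoundedSignal z := hF.boundedSignal hz
    (hu.comp (Φ := fun r : ℝ => r • b) (by fun_prop))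
  exact .of_hasDerivWithinAt hzb hz ((hzb.prodMk hu).comp
    (Φ := fun q : (Fin n → ℝ) × ℝ => F *ᵥ q.1 + q.2 • b) (by fun_prop))

theorem IsHurwitz.bddUniformContinuous {n : ℕ} {F : Matrix (Fin n) (Fin n) ℝ}
    (hF : IsHurwitz F) {z : ℝ → Fin n → ℝ}
    (hz : ∀ t : ℝ, 0 ≤ t → HasDerivWithinAt z (F *ᵥ z t) (Ici 0) t) : BddUniformContinuous z :=
  IsFilterState.bddUniformContinuous (b := 0) (u := 0) hF (fun t ht => by simpa using hz t ht)
    ⟨0, by simp⟩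

section GlobalExistence

variable {E : Type*} [NormedAddCommGroup E] [NormedSpace ℝ E]

open scoped NNReal BoundedContinuousFunction

theorem norm_integral_le_of_norm_le_exp {h : ℝ → E} {l C τ : ℝ} (hl : 0 < l) (hτ : 0 ≤ τ)
    (hb : ∀ s : ℝ, 0 ≤ s → ‖h s‖ ≤ C * Real.exp (l * s)) :
    ‖∫ s in (0 : ℝ)..τ, h s‖ ≤ C / l * Real.exp (l * τ) := by
  have hC : 0 ≤ C := by simpa using (norm_nonneg _).trans (hb 0 le_rfl)
  have hd : ∀ s : ℝ, HasDerivAt (fun s => C / l * Real.exp (l * s)) (C * Real.exp (l * s)) s :=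
    fun s => by
      refine (((hasDerivAt_id s).const_mul l).exp.const_mul (C / l)).congr_deriv ?_
      simp only [id_eq]
      field_simp
  have hi : IntervalIntegrable (fun s => C * Real.exp (l * s)) MeasureTheory.volume 0 τ :=
    (by fun_prop : Continuous fun s => C * Real.exp (l * s)).intervalIntegrable _ _
  calc ‖∫ s in (0 : ℝ)..τ, h s‖ ≤ ∫ s in (0 : ℝ)..τ, C * Real.exp (l * s) :=
        intervalIntegral.norm_integral_le_of_norm_le hτ
          (Eventually.of_forall fun s hs => hb s hs.1.le) hi
    _ = C / l * Real.exp (l * τ) - C / l * Real.exp (l * 0) :=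
        intervalIntegral.integral_eq_sub_of_hasDerivAt (fun s _ => hd s) hi
    _ ≤ C / l * Real.exp (l * τ) := sub_le_self _ (by positivity)

theorem norm_exp_smul_integral_le {h : ℝ → E} {l C τ : ℝ} (hl : 0 < l) (hτ : 0 ≤ τ)
    (hb : ∀ s : ℝ, 0 ≤ s → ‖h s‖ ≤ C * Real.exp (l * s)) :
    ‖Real.exp (-l * τ) • ∫ s in (0 : ℝ)..τ, h s‖ ≤ C / l := by
  rw [norm_smul, Real.norm_of_nonneg (Real.exp_pos _).le, neg_mul, Real.exp_neg,
    inv_mul_le_iff₀ (Real.exp_pos _), mul_comm (Real.exp _)]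
  exact norm_integral_le_of_norm_le_exp hl hτ hb

/-- The Picard iterate of `exp (l ·) w` for the initial value problem `x' = f t x`, `x 0 = x₀`.
The fixed point argument runs on the rescaled function `w`, since the solution itself may grow
exponentially. -/
noncomputable def expPicard (f : ℝ → E → E) (l : ℝ) (x₀ : E) (w : ℝ → E) (t : ℝ) : E :=
  x₀ + ∫ s in (0 : ℝ)..t, f s (Real.exp (l * s) • w s)

variable {f : ℝ → E → E} {K : ℝ≥0} {l B : ℝ}

theorem continuous_expPicard_integrand (hf : Continuous (Function.uncurry f)) {w : ℝ → E}
    (hw : Continuous w) : Continuous fun s => f s (Real.exp (l * s) • w s) :=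
  hf.comp (by fun_prop : Continuous fun s : ℝ => (s, Real.exp (l * s) • w s))

theorem norm_expPicard_integrand_sub_le (hK : ∀ t, LipschitzWith K (f t)) (w w' : ℝ →ᵇ E)
    (s : ℝ) :
    ‖f s (Real.exp (l * s) • w s) - f s (Real.exp (l * s) • w' s)‖ ≤
      K * ‖w - w'‖ * Real.exp (l * s) :=
  calc ‖f s (Real.exp (l * s) • w s) - f s (Real.exp (l * s) • w' s)‖
      ≤ K * ‖Real.exp (l * s) • w s - Real.exp (l * s) • w' s‖ := (hK s).norm_sub_le _ _
    _ = K * (Real.exp (l * s) * ‖(w - w') s‖) := by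
        rw [← smul_sub, norm_smul, Real.norm_of_nonneg (Real.exp_pos _).le]
        rfl
    _ ≤ K * (Real.exp (l * s) * ‖w - w'‖) := by
        gcongr
        exact (w - w').norm_coe_le_norm s
    _ = K * ‖w - w'‖ * Real.exp (l * s) := by ring

theorem norm_expPicard_integrand_le (hK : ∀ t, LipschitzWith K (f t)) (hB : ∀ t, ‖f t 0‖ ≤ B)
    (hl : 0 ≤ l) (w : ℝ →ᵇ E) {s : ℝ} (hs : 0 ≤ s) :
    ‖f s (Real.exp (l * s) • w s)‖ ≤ (B + K * ‖w‖) * Real.exp (l * s) := by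
  have hsub := norm_expPicard_integrand_sub_le (l := l) hK w 0 s
  rw [BoundedContinuousFunction.coe_zero, Pi.zero_apply, smul_zero, sub_zero] at hsub
  have hB0 : 0 ≤ B := (norm_nonneg _).trans (hB s)
  have hexp : 1 ≤ Real.exp (l * s) := Real.one_le_exp (by positivity)
  calc ‖f s (Real.exp (l * s) • w s)‖
      ≤ ‖f s 0‖ + ‖f s (Real.exp (l * s) • w s) - f s 0‖ := norm_le_insert' _ _
    _ ≤ B * Real.exp (l * s) + K * ‖w‖ * Real.exp (l * s) :=
        add_le_add ((hB s).trans (le_mul_of_one_le_right hB0 hexp)) hsub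
    _ = (B + K * ‖w‖) * Real.exp (l * s) := by ring

theorem norm_exp_smul_expPicard_le (hK : ∀ t, LipschitzWith K (f t)) (hB : ∀ t, ‖f t 0‖ ≤ B)
    (hl : 0 < l) (x₀ : E) (w : ℝ →ᵇ E) {t : ℝ} (ht : 0 ≤ t) :
    ‖Real.exp (-l * t) • expPicard f l x₀ w t‖ ≤ ‖x₀‖ + (B + K * ‖w‖) / l := by
  rw [expPicard, smul_add]
  refine norm_add_le_of_le ?_ (norm_exp_smul_integral_le hl ht fun s hs =>
    norm_expPicard_integrand_le hK hB hl.le w hs)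
  rw [norm_smul, Real.norm_of_nonneg (Real.exp_pos _).le]
  exact mul_le_of_le_one_left (norm_nonneg _) (Real.exp_le_one_iff.2 (by nlinarith))

theorem norm_exp_smul_expPicard_sub_le (hf : Continuous (Function.uncurry f))
    (hK : ∀ t, LipschitzWith K (f t)) (hl : 0 < l) (x₀ : E) (w w' : ℝ →ᵇ E) {t : ℝ}
    (ht : 0 ≤ t) :
    ‖Real.exp (-l * t) • expPicard f l x₀ w t - Real.exp (-l * t) • expPicard f l x₀ w' t‖ ≤
      K / l * ‖w - w'‖ := by
  have hint : ∀ w : ℝ →ᵇ E, IntervalIntegrable (fun s => f s (Real.exp (l * s) • w s))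
      MeasureTheory.volume 0 t := fun w =>
    (continuous_expPicard_integrand hf w.continuous).intervalIntegrable _ _
  rw [← smul_sub, expPicard, expPicard, add_sub_add_left_eq_sub,
    ← intervalIntegral.integral_sub (hint w) (hint w'), div_mul_eq_mul_div]
  exact norm_exp_smul_integral_le hl ht fun s _ => norm_expPicard_integrand_sub_le hK w w' s

variable [CompleteSpace E]

theorem hasDerivAt_expPicard (hf : Continuous (Function.uncurry f)) (x₀ : E) {w : ℝ → E}
    (hw : Continuous w) (t : ℝ) :
    HasDerivAt (expPicard f l x₀ w) (f t (Real.exp (l * t) • w t)) t := by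
  have hc := continuous_expPicard_integrand (l := l) hf hw
  exact (intervalIntegral.integral_hasDerivAt_right (hc.intervalIntegrable _ _)
    (hc.stronglyMeasurableAtFilter _ _) hc.continuousAt).const_add x₀

theorem exists_eq_exp_smul_expPicard (hf : Continuous (Function.uncurry f))
    (hK : ∀ t, LipschitzWith K (f t)) (hB : ∀ t, ‖f t 0‖ ≤ B) (hl : 0 < l) (hKl : 2 * K ≤ l)
    (x₀ : E) :
    ∃ w : ℝ →ᵇ E, ∀ t : ℝ, 0 ≤ t → w t = Real.exp (-l * t) • expPicard f l x₀ w t := by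
  have hcont : ∀ w : ℝ →ᵇ E,
      Continuous fun t => Real.exp (-l * max t 0) • expPicard f l x₀ w (max t 0) := fun w => by
    have hI : Continuous (expPicard f l x₀ w) := continuous_iff_continuousAt.2 fun t =>
      (hasDerivAt_expPicard hf x₀ w.continuous t).continuousAt
    fun_prop
  set Φ : (ℝ →ᵇ E) → ℝ →ᵇ E := fun w => BoundedContinuousFunction.ofNormedAddCommGroup _
    (hcont w) _ fun t => norm_exp_smul_expPicard_le hK hB hl x₀ w (le_max_right t 0)
  have hΦ : ContractingWith (1 / 2) Φ := by
    refine ⟨by norm_num, LipschitzWith.of_dist_le_mul fun w w' => ?_⟩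
    rw [dist_eq_norm w w', BoundedContinuousFunction.dist_le (by positivity)]
    intro t
    rw [dist_eq_norm]
    refine (norm_exp_smul_expPicard_sub_le hf hK hl x₀ w w' (le_max_right t 0)).trans ?_
    gcongr
    rw [div_le_iff₀ hl]
    push_cast
    linarith
  refine ⟨ContractingWith.fixedPoint Φ hΦ, fun t ht => ?_⟩
  have hfix := DFunLike.congr_fun hΦ.fixedPoint_isFixedPt t
  conv_lhs => rw [← hfix]
  simp only [Φ, BoundedContinuousFunction.coe_ofNormedAddCommGroup, max_eq_left ht]

theorem exists_solution_of_lipschitz (hf : Continuous (Function.uncurry f))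
    (hK : ∀ t, LipschitzWith K (f t)) (hB : ∀ t, ‖f t 0‖ ≤ B) (x₀ : E) :
    ∃ x : ℝ → E, x 0 = x₀ ∧
      ∀ t : ℝ, 0 ≤ t → HasDerivWithinAt x (f t (x t)) (Ici 0) t := by
  set l : ℝ := 2 * K + 1
  obtain ⟨w, hw⟩ := exists_eq_exp_smul_expPicard (l := l) hf hK hB (by positivity)
    (by simp [l]) x₀
  refine ⟨expPicard f l x₀ w, by simp [expPicard], fun t ht => ?_⟩
  have hx : expPicard f l x₀ w t = Real.exp (l * t) • w t := by
    rw [hw t ht, smul_smul, ← Real.exp_add]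
    simp
  exact hx ▸ (hasDerivAt_expPicard hf x₀ w.continuous t).hasDerivWithinAt

theorem exists_solution_of_lipschitz_Ici
    (hf : ContinuousOn (Function.uncurry f) (Ici 0 ×ˢ univ))
    (hK : ∀ t : ℝ, 0 ≤ t → LipschitzWith K (f t)) (hB : ∀ t : ℝ, 0 ≤ t → ‖f t 0‖ ≤ B) (x₀ : E) :
    ∃ x : ℝ → E, x 0 = x₀ ∧
      ∀ t : ℝ, 0 ≤ t → HasDerivWithinAt x (f t (x t)) (Ici 0) t := by
  have hclamp : Continuous fun p : ℝ × E => (max p.1 0, p.2) := by fun_prop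
  obtain ⟨x, hx0, hx⟩ := exists_solution_of_lipschitz (f := fun t => f (max t 0))
    (hf.comp_continuous hclamp fun p => ⟨le_max_right p.1 0, mem_univ _⟩)
    (fun t => hK _ (le_max_right _ _)) (fun t => hB _ (le_max_right _ _)) x₀
  exact ⟨x, hx0, fun t ht => by simpa only [max_eq_left ht] using hx t ht⟩

theorem exists_solution_linear (A : E →L[ℝ] E) {g : ℝ → E} (hg : ContinuousOn g (Ici 0))
    (hgb : BoundedSignal g) (x₀ : E) :
    ∃ x : ℝ → E, x 0 = x₀ ∧
      ∀ t : ℝ, 0 ≤ t → HasDerivWithinAt x (A (x t) + g t) (Ici 0) t := by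
  obtain ⟨B, hB⟩ := hgb
  refine exists_solution_of_lipschitz_Ici (f := fun t x => A x + g t) (K := ‖A‖₊) (B := B)
    ((A.continuous.comp continuous_snd).continuousOn.add
      (hg.comp continuousOn_fst fun p hp => hp.1))
    (fun t _ => by simpa using A.lipschitz.add (LipschitzWith.const (g t)))
    (by simpa using hB) x₀

end GlobalExistence

theorem exists_isFilterState {n : ℕ} (F : Matrix (Fin n) (Fin n) ℝ) (b : Fin n → ℝ) {u : ℝ → ℝ}
    (hu : BddUniformContinuous u) (z₀ : Fin n → ℝ) :
    ∃ z, IsFilterState F b u z ∧ z 0 = z₀ := by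
  obtain ⟨z, hz0, hz⟩ := exists_solution_linear (Matrix.mulVecLin F).toContinuousLinearMap
    (g := fun t => u t • b) (hu.uniform.continuousOn.smul continuousOn_const)
    (hu.bounded.comp (Φ := fun r : ℝ => r • b) (by fun_prop)) z₀
  exact ⟨z, fun t ht => by simpa using hz t ht, hz0⟩

section DifferentialPolynomial

open Polynomial

/-- The scalar signals that are bounded and uniformly continuous on `[0, ∞)`. -/
def bddUniformContinuousSignals : Submodule ℂ (ℝ → ℂ) where
  carrier := {f | BddUniformContinuous f}
  zero_mem' := ⟨⟨0, by simp⟩, uniformContinuous_const.uniformContinuousOn⟩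
  add_mem' := fun hf hg => (hf.prodMk hg).comp (Φ := fun q : ℂ × ℂ => q.1 + q.2) (by fun_prop)
  smul_mem' := fun a _ hf => hf.comp (Φ := fun z : ℂ => a • z) (by fun_prop)

theorem isFilterStable_bddUniformContinuousSignals :
    IsFilterStable bddUniformContinuousSignals := fun l w g hl hw hg => by
  have hwb : BoundedSignal w := isFilterStable_boundedSignals hl hw hg.bounded
  exact .of_hasDerivWithinAt hwb hw ((hwb.prodMk hg.bounded).comp
    (Φ := fun q : ℂ × ℂ => l * q.1 + q.2) (by fun_prop))

/-- A solution `ξ` on `[0, ∞)` of the differential equation `D(d/dt) ξ = u`, encoded by the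
assignment of the signal `q(d/dt) ξ` to each polynomial `q` of degree at most that of `D`. -/
structure IsDifferentialSolution (D : ℂ[X]) (u : ℝ → ℂ) (Φ : ℂ[X] →ₗ[ℂ] ℝ → ℂ) : Prop where
  map_eq : Φ D = u
  hasDerivWithinAt : ∀ q : ℂ[X], q.natDegree < D.natDegree → ∀ t : ℝ, 0 ≤ t →
    HasDerivWithinAt (Φ q) (Φ (X * q) t) (Ici 0) t

/-- The signal `q(d/dt) ξ` expressed through the derivatives `η i` of `ξ` of order less than the
degree `n` of the monic polynomial `D`: the top derivative is eliminated by `D(d/dt) ξ = u`. -/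
def companionOutput (D : ℂ[X]) (u : ℝ → ℂ) (η : ℝ → Fin D.natDegree → ℂ) :
    ℂ[X] →ₗ[ℂ] ℝ → ℂ where
  toFun q t := (fun i : Fin D.natDegree => q.coeff i - q.coeff D.natDegree * D.coeff i) ⬝ᵥ η t +
    q.coeff D.natDegree * u t
  map_add' p q := by
    ext t
    simp only [coeff_add, dotProduct, Pi.add_apply]
    simp only [add_mul, sub_mul, Finset.sum_add_distrib, Finset.sum_sub_distrib]
    ring
  map_smul' a q := by
    ext t
    simp only [coeff_smul, dotProduct, smul_eq_mul, Pi.smul_apply, RingHom.id_apply, mul_add,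
      Finset.mul_sum, sub_mul, mul_sub, mul_assoc]

theorem companionOutput_apply (D : ℂ[X]) (u : ℝ → ℂ) (η : ℝ → Fin D.natDegree → ℂ) (q : ℂ[X])
    (t : ℝ) :
    companionOutput D u η q t =
      (fun i : Fin D.natDegree => q.coeff i - q.coeff D.natDegree * D.coeff i) ⬝ᵥ η t +
        q.coeff D.natDegree * u t := rfl

theorem companionOutput_of_natDegree_lt {D q : ℂ[X]} (hq : q.natDegree < D.natDegree)
    (u : ℝ → ℂ) (η : ℝ → Fin D.natDegree → ℂ) :
    companionOutput D u η q = fun t => (fun i : Fin D.natDegree => q.coeff i) ⬝ᵥ η t := by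
  ext t
  simp [companionOutput_apply, coeff_eq_zero_of_natDegree_lt hq]

theorem X_mul_eq_sum_of_natDegree_lt {q : ℂ[X]} {n : ℕ} (hq : q.natDegree < n) :
    X * q = ∑ i : Fin n, q.coeff i • (X : ℂ[X]) ^ ((i : ℕ) + 1) := by
  rw [Fin.sum_univ_eq_sum_range (fun i => q.coeff i • (X : ℂ[X]) ^ (i + 1)) n]
  conv_lhs => rw [q.as_sum_range_C_mul_X_pow' hq, Finset.mul_sum]
  refine Finset.sum_congr rfl fun i _ => ?_
  rw [smul_eq_C_mul]
  ring

theorem isDifferentialSolution_companionOutput {D : ℂ[X]} (hD : D.Monic) {u : ℝ → ℂ}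
    {η : ℝ → Fin D.natDegree → ℂ}
    (hη : ∀ t : ℝ, 0 ≤ t →
      HasDerivWithinAt η (fun i => companionOutput D u η (X ^ ((i : ℕ) + 1)) t) (Ici 0) t) :
    IsDifferentialSolution D u (companionOutput D u η) := by
  refine ⟨?_, fun q hq t ht => ?_⟩
  · ext t
    simp [companionOutput_apply, hD.coeff_natDegree, dotProduct]
  · rw [companionOutput_of_natDegree_lt hq, X_mul_eq_sum_of_natDegree_lt hq]
    refine (hasDerivWithinAt_dotProduct (hasDerivWithinAt_const t (Ici 0) _)
      (hη t ht)).congr_deriv ?_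
    simp [dotProduct, Finset.sum_apply]

theorem exists_isDifferentialSolution {D : ℂ[X]} (hD : D.Monic) {u : ℝ → ℂ}
    (hu : BddUniformContinuous u) : ∃ Φ, IsDifferentialSolution D u Φ := by
  set G : Matrix (Fin D.natDegree) (Fin D.natDegree) ℂ := Matrix.of fun i j =>
    ((X : ℂ[X]) ^ ((i : ℕ) + 1)).coeff j -
      ((X : ℂ[X]) ^ ((i : ℕ) + 1)).coeff D.natDegree * D.coeff j
  set e : Fin D.natDegree → ℂ := fun i => ((X : ℂ[X]) ^ ((i : ℕ) + 1)).coeff D.natDegree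
  obtain ⟨η, -, hη⟩ := exists_solution_linear
    ((Matrix.mulVecLin G).restrictScalars ℝ).toContinuousLinearMap
    (g := fun t => u t • e) (hu.uniform.continuousOn.smul continuousOn_const)
    (hu.bounded.comp (Φ := fun r : ℂ => r • e) (by fun_prop)) 0
  refine ⟨_, isDifferentialSolution_companionOutput hD (η := η) fun t ht =>
    (hη t ht).congr_deriv ?_⟩
  ext i
  simp [G, e, companionOutput_apply, mulVec, mul_comm]

namespace IsDifferentialSolution

variable {D : ℂ[X]} {u : ℝ → ℂ} {Φ : ℂ[X] →ₗ[ℂ] ℝ → ℂ}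

theorem mem_of_mul_mem (hΦ : IsDifferentialSolution D u Φ) {S : Submodule ℂ (ℝ → ℂ)}
    (hS : IsFilterStable S) {p q : ℂ[X]} (hp : IsHurwitzPolynomial p)
    (hdeg : q.natDegree + p.natDegree ≤ D.natDegree) (hqp : Φ (q * p) ∈ S) : Φ q ∈ S :=
  hS.mem_of_mul_mem (r := 0) (fun q hq t ht => by simpa using hΦ.hasDerivWithinAt q hq t ht)
    (fun _ _ => S.zero_mem) hp hdeg hqp

-- Barbalat's lemma, applied once for each root of `p`.
theorem tendsto_mul (hΦ : IsDifferentialSolution D u Φ) {p q : ℂ[X]}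
    (hp : IsHurwitzPolynomial p) (hdeg : q.natDegree + p.natDegree ≤ D.natDegree)
    (hqp : BddUniformContinuous (Φ (q * p))) (hq : Tendsto (Φ q) atTop (𝓝 0)) :
    Tendsto (Φ (q * p)) atTop (𝓝 0) := by
  induction p, hp using IsHurwitzPolynomial.induction_on generalizing q with
  | C a =>
    rw [mul_comm, ← smul_eq_C_mul, map_smul]
    exact vanishingSignals.smul_mem a hq
  | X_sub_C_mul l p _ hp ih hlp =>
    obtain ⟨hqD, hqX⟩ := natDegree_mul_X_sub_C_add_le hp.ne_zero hdeg
    have hbuc : BddUniformContinuous (Φ q) :=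
      hΦ.mem_of_mul_mem isFilterStable_bddUniformContinuousSignals hlp hdeg hqp
    rw [← mul_assoc] at hqp ⊢
    have hbucX : BddUniformContinuous (Φ (q * (X - C l))) :=
      hΦ.mem_of_mul_mem isFilterStable_bddUniformContinuousSignals hp hqX hqp
    refine ih hqX hqp ?_
    have hderiv : Tendsto (Φ (X * q)) atTop (𝓝 0) := by
      refine tendsto_deriv_zero_of_tendsto (hΦ.hasDerivWithinAt q hqD) ?_ hq
      rw [map_X_mul_eq]
      exact (bddUniformContinuousSignals.add_mem
        (bddUniformContinuousSignals.smul_mem l hbuc) hbucX).uniform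
    rw [eq_sub_of_add_eq' (map_X_mul_eq Φ l q).symm]
    exact vanishingSignals.sub_mem hderiv (vanishingSignals.smul_mem l hq)

theorem tendsto_input (hΦ : IsDifferentialSolution D u Φ) (hD : IsHurwitzPolynomial D)
    (hu : BddUniformContinuous u) {N : ℂ[X]} (hN : IsHurwitzPolynomial N)
    (hdeg : N.natDegree ≤ D.natDegree) (hout : Tendsto (Φ N) atTop (𝓝 0)) :
    Tendsto u atTop (𝓝 0) := by
  have hone : Tendsto (Φ 1) atTop (𝓝 0) :=
    hΦ.mem_of_mul_mem isFilterStable_vanishingSignals hN (by simpa using hdeg)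
      ((one_mul N).symm ▸ hout)
  have h := hΦ.tendsto_mul hD (by simp) (by simpa [hΦ.map_eq] using hu) hone
  rwa [one_mul, hΦ.map_eq] at h

end IsDifferentialSolution

end DifferentialPolynomial

section ResolventNumerator

open Polynomial

variable {ι R : Type*} [Fintype ι] [DecidableEq ι] [CommRing R]

/-- The polynomial vector `adj(X - F) b`, the numerator of `(X - F)⁻¹ b` over the common
denominator `F.charpoly`. -/
noncomputable def resolventNumerator (F : Matrix ι ι R) (b : ι → R) : ι → R[X] :=
  F.charmatrix.adjugate *ᵥ fun i => C (b i)

theorem X_mul_resolventNumerator (F : Matrix ι ι R) (b : ι → R) (i : ι) :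
    X * resolventNumerator F b i =
      ∑ j, C (F i j) * resolventNumerator F b j + F.charpoly * C (b i) := by
  have hmul : F.charmatrix *ᵥ resolventNumerator F b = F.charpoly • fun i => C (b i) := by
    rw [resolventNumerator, mulVec_mulVec, mul_adjugate, smul_mulVec, one_mulVec]
    rfl
  have h := congrFun hmul i
  rw [charmatrix, sub_mulVec, Pi.sub_apply, Pi.smul_apply, smul_eq_mul] at h
  rw [← h]
  simp [mulVec, dotProduct, diagonal_apply]

theorem natDegree_resolventNumerator_lt [Nontrivial R] (F : Matrix ι ι R) (b : ι → R) (i : ι) :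
    (resolventNumerator F b i).natDegree < Fintype.card ι := by
  have : Nonempty ι := ⟨i⟩
  obtain ⟨k, hk⟩ := Finite.exists_max fun i => (resolventNumerator F b i).natDegree
  refine (hk i).trans_lt ?_
  by_contra! hcon
  have hne : resolventNumerator F b k ≠ 0 := fun h0 => by
    rw [h0, natDegree_zero, Nat.le_zero] at hcon
    exact Fintype.card_ne_zero hcon
  have hle : (X * resolventNumerator F b k).natDegree ≤ (resolventNumerator F b k).natDegree := by
    rw [X_mul_resolventNumerator]
    refine natDegree_add_le_of_degree_le
      (natDegree_sum_le_of_forall_le _ _ fun j _ => (natDegree_C_mul_le _ _).trans (hk j)) ?_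
    exact (natDegree_mul_C_le _ _).trans (F.charpoly_natDegree_eq_dim.trans_le hcon)
  rw [natDegree_X_mul hne] at hle
  omega

end ResolventNumerator

section MinimumPhase

open Polynomial

variable {n : ℕ} {F : Matrix (Fin n) (Fin n) ℝ} {b c : Fin n → ℝ}

/-- The numerator of the transfer function `cᵀ (s I - F)⁻¹ b` over the denominator
`F.charpoly`. -/
noncomputable def transferNumerator (F : Matrix (Fin n) (Fin n) ℝ) (b c : Fin n → ℝ) : ℂ[X] :=
  ∑ i, (c i : ℂ) • resolventNumerator (F.map (algebraMap ℝ ℂ)) (fun i => (b i : ℂ)) i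

theorem natDegree_transferNumerator_le (F : Matrix (Fin n) (Fin n) ℝ) (b c : Fin n → ℝ) :
    (transferNumerator F b c).natDegree ≤ n :=
  natDegree_sum_le_of_forall_le _ _ fun i _ => (natDegree_smul_le _ _).trans
    (by simpa using (natDegree_resolventNumerator_lt _ _ i).le)

theorem eval_transferNumerator {s : ℂ} (hs : s ∉ spectrum ℂ (F.map (algebraMap ℝ ℂ))) :
    (transferNumerator F b c).eval s =
      (F.map (algebraMap ℝ ℂ)).charpoly.eval s * transferFunction F b c s := by
  set Fc := F.map (algebraMap ℝ ℂ) with hFc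
  set v := resolventNumerator Fc fun i => (b i : ℂ) with hv
  have hunit : IsUnit (s • (1 : Matrix (Fin n) (Fin n) ℂ) - Fc) := by
    rw [← Algebra.algebraMap_eq_smul_one]
    exact spectrum.notMem_iff.1 hs
  have hsolve : (s • (1 : Matrix (Fin n) (Fin n) ℂ) - Fc) *ᵥ (fun i => (v i).eval s) =
      Fc.charpoly.eval s • fun i => (b i : ℂ) := by
    ext i
    have h := congrArg (Polynomial.eval s) (X_mul_resolventNumerator Fc (fun i => (b i : ℂ)) i)
    simp only [← hv, eval_mul, eval_X, eval_add, eval_finsetSum, eval_C] at h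
    rw [sub_mulVec, smul_mulVec, one_mulVec]
    simp only [Pi.sub_apply, Pi.smul_apply, smul_eq_mul, h, mulVec, dotProduct,
      add_sub_cancel_left]
  have heval : (fun i => (v i).eval s) = Fc.charpoly.eval s •
      ((s • (1 : Matrix (Fin n) (Fin n) ℂ) - Fc)⁻¹ *ᵥ fun i => (b i : ℂ)) := by
    rw [← mulVec_smul, ← hsolve, mulVec_mulVec,
      nonsing_inv_mul _ ((isUnit_iff_isUnit_det _).1 hunit), one_mulVec]
  calc (transferNumerator F b c).eval s = (fun i => (c i : ℂ)) ⬝ᵥ fun i => (v i).eval s := by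
        simp [transferNumerator, eval_finsetSum, dotProduct, hFc, hv]
    _ = Fc.charpoly.eval s * transferFunction F b c s := by
        rw [heval, dotProduct_smul, smul_eq_mul]
        rfl

theorem IsMinimumPhase.isHurwitzPolynomial_transferNumerator (hH : IsMinimumPhase F b c)
    (hF : IsHurwitz F) : IsHurwitzPolynomial (transferNumerator F b c) := by
  intro s hs
  by_cases hspec : s ∈ spectrum ℂ (F.map (algebraMap ℝ ℂ))
  · exact hF s hspec
  rw [IsRoot, eval_transferNumerator hspec, mul_eq_zero] at hs
  exact hs.elim (hF.isHurwitzPolynomial_charpoly s) (hH s)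

variable {u : ℝ → ℝ} {Φ : ℂ[X] →ₗ[ℂ] ℝ → ℂ} {z : ℝ → Fin n → ℝ}

theorem IsDifferentialSolution.hasDerivWithinAt_resolventNumerator
    (hΦ : IsDifferentialSolution (F.map (algebraMap ℝ ℂ)).charpoly (fun t => (u t : ℂ)) Φ)
    {t : ℝ} (ht : 0 ≤ t) (i : Fin n) :
    HasDerivWithinAt
      (Φ (resolventNumerator (F.map (algebraMap ℝ ℂ)) (fun i => (b i : ℂ)) i))
      (∑ j, (F i j : ℂ) *
        Φ (resolventNumerator (F.map (algebraMap ℝ ℂ)) (fun i => (b i : ℂ)) j) t + u t * b i)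
      (Ici 0) t := by
  set Fc := F.map (algebraMap ℝ ℂ) with hFc
  refine (hΦ.hasDerivWithinAt _ ?_ t ht).congr_deriv ?_
  · rw [charpoly_natDegree_eq_dim]
    exact natDegree_resolventNumerator_lt _ _ i
  · rw [X_mul_resolventNumerator, map_add, map_sum, mul_comm Fc.charpoly]
    simp only [← smul_eq_C_mul, map_smul, hΦ.map_eq]
    simp [hFc, Finset.sum_apply, mul_comm]

theorem IsFilterState.tendsto_transferNumerator_sub (hz : IsFilterState F b u z)
    (hF : IsHurwitz F)
    (hΦ : IsDifferentialSolution (F.map (algebraMap ℝ ℂ)).charpoly (fun t => (u t : ℂ)) Φ)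
    (c : Fin n → ℝ) :
    Tendsto (fun t => Φ (transferNumerator F b c) t - ((c ⬝ᵥ z t : ℝ) : ℂ)) atTop (𝓝 0) := by
  set Fc := F.map (algebraMap ℝ ℂ) with hFc
  set v := resolventNumerator Fc fun i => (b i : ℂ) with hv
  have herr : ∀ t : ℝ, 0 ≤ t →
      HasDerivWithinAt (fun t i => Φ (v i) t - (z t i : ℂ))
        (Fc *ᵥ (fun i => Φ (v i) t - (z t i : ℂ)) + 0) (Ici 0) t := fun t ht => by
    refine hasDerivWithinAt_pi.2 fun i => ((hΦ.hasDerivWithinAt_resolventNumerator ht i).sub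
      (hasDerivWithinAt_pi.1 (hasDerivWithinAt_ofReal_mulVec_add (f := fun t => u t • b)
        (hz t ht)) i)).congr_deriv ?_
    simp [hFc, hv, mulVec, dotProduct, mul_sub, Finset.sum_sub_distrib]
  have h := isFilterStable_vanishingSignals.dotProduct_mem hF.isHurwitzPolynomial_charpoly
    (f := fun _ => 0) herr (fun _ => vanishingSignals.zero_mem) fun i => (c i : ℂ)
  refine Tendsto.congr (fun t => ?_) h
  simp [transferNumerator, hFc, hv, dotProduct, mul_sub, Finset.sum_sub_distrib,
    Finset.sum_apply]

theorem IsMinimumPhase.tendsto_input (hH : IsMinimumPhase F b c) (hF : IsHurwitz F)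
    (hu : BddUniformContinuous u) (hz : IsFilterState F b u z)
    (hout : Tendsto (fun t => c ⬝ᵥ z t) atTop (𝓝 0)) : Tendsto u atTop (𝓝 0) := by
  have huc : BddUniformContinuous fun t => (u t : ℂ) := hu.comp Complex.continuous_ofReal
  obtain ⟨Φ, hΦ⟩ := exists_isDifferentialSolution (charpoly_monic (F.map (algebraMap ℝ ℂ))) huc
  have hN : Tendsto (Φ (transferNumerator F b c)) atTop (𝓝 0) := by
    have houtc : Tendsto (fun t => ((c ⬝ᵥ z t : ℝ) : ℂ)) atTop (𝓝 ((0 : ℝ) : ℂ)) :=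
      tendsto_ofReal_iff.2 hout
    simpa using (hz.tendsto_transferNumerator_sub hF hΦ c).add houtc
  refine (tendsto_ofReal_iff (x := 0)).1 (?_ : Tendsto (fun t => (u t : ℂ)) atTop (𝓝 0))
  refine hΦ.tendsto_input hF.isHurwitzPolynomial_charpoly huc
    (hH.isHurwitzPolynomial_transferNumerator hF) ?_ hN
  rw [charpoly_natDegree_eq_dim, Fintype.card_fin]
  exact natDegree_transferNumerator_le F b c

end MinimumPhase

theorem exists_tendsto_of_antitoneOn_Ici {W : ℝ → ℝ} {a : ℝ} (hW : AntitoneOn W (Ici a))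
    (hbdd : BddBelow (W '' Ici a)) : ∃ l, Tendsto W atTop (𝓝 l) := by
  have hanti : Antitone fun t => W (max t a) := fun s t hst =>
    hW (le_max_right s a) (le_max_right t a) (max_le_max_right a hst)
  have hlim := tendsto_atTop_ciInf hanti
    (hbdd.mono (range_subset_iff.2 fun t => mem_image_of_mem W (le_max_right t a)))
  refine ⟨_, hlim.congr' ?_⟩
  filter_upwards [eventually_ge_atTop a] with t ht
  rw [max_eq_left ht]

theorem tendsto_exp_neg_mul_atTop {μ : ℝ} (hμ : 0 < μ) :
    Tendsto (fun t => Real.exp (-μ * t)) atTop (𝓝 0) :=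
  Real.tendsto_exp_atBot.comp (tendsto_id.const_mul_atTop_of_neg (neg_neg_of_pos hμ))

theorem ExpDecaying.tendsto_zero {E : Type*} [NormedAddCommGroup E] {f : ℝ → E}
    (hf : ExpDecaying f) : Tendsto f atTop (𝓝 0) := by
  obtain ⟨μ, hμ, M, hM⟩ := hf
  have hlim : Tendsto (fun t => M * Real.exp (-μ * t)) atTop (𝓝 0) :=
    mul_zero M ▸ (tendsto_exp_neg_mul_atTop hμ).const_mul M
  refine squeeze_zero_norm' ?_ hlim
  filter_upwards [eventually_ge_atTop 0] with t ht using hM t ht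

section GradientLaw

variable {ι : Type*} [Fintype ι] {γ : ℝ} {ω p : ℝ → ι → ℝ} {d : ℝ → ℝ}

theorem norm_le_sqrt_dotProduct_self (v : ι → ℝ) : ‖v‖ ≤ √(v ⬝ᵥ v) := by
  refine (pi_norm_le_iff_of_nonneg (Real.sqrt_nonneg _)).2 fun i => Real.abs_le_sqrt ?_
  rw [sq]
  exact Finset.single_le_sum (f := fun i => v i * v i) (fun i _ => mul_self_nonneg _)
    (Finset.mem_univ i)

/-- `p` is the parameter error of the gradient law with regressor `ω`, gain `γ` and disturbance
`d` added to the prediction error `ωᵀ p`. -/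
def IsGradientSolution (γ : ℝ) (ω : ℝ → ι → ℝ) (d : ℝ → ℝ) (p : ℝ → ι → ℝ) : Prop :=
  ∀ t : ℝ, 0 ≤ t → HasDerivWithinAt p (-(γ * (d t + ω t ⬝ᵥ p t)) • ω t) (Ici 0) t

namespace IsGradientSolution

theorem hasDerivWithinAt_dotProduct_self (hp : IsGradientSolution γ ω d p) (t : ℝ)
    (ht : 0 ≤ t) :
    HasDerivWithinAt (fun t => p t ⬝ᵥ p t)
      (-2 * γ * ((d t + ω t ⬝ᵥ p t) * (ω t ⬝ᵥ p t))) (Ici 0) t := by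
  refine (hasDerivWithinAt_dotProduct (hp t ht) (hp t ht)).congr_deriv ?_
  rw [smul_dotProduct, dotProduct_smul, dotProduct_comm (p t), smul_eq_mul]
  ring

-- The added term integrates the upper bound `γ d²` of the derivative of `|p|²`.
theorem antitoneOn_dotProduct_self_add (hγ : 0 < γ) {μ K : ℝ} (hμ : 0 < μ)
    (hd : ∀ t : ℝ, 0 ≤ t → |d t| ≤ K * Real.exp (-μ * t)) (hp : IsGradientSolution γ ω d p) :
    AntitoneOn (fun t => p t ⬝ᵥ p t + γ * K ^ 2 / (2 * μ) * Real.exp (-(2 * μ) * t))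
      (Ici 0) := by
  have hderiv : ∀ t : ℝ, 0 ≤ t → HasDerivWithinAt
      (fun t => p t ⬝ᵥ p t + γ * K ^ 2 / (2 * μ) * Real.exp (-(2 * μ) * t))
      (-2 * γ * ((d t + ω t ⬝ᵥ p t) * (ω t ⬝ᵥ p t)) +
        -(γ * K ^ 2 * Real.exp (-(2 * μ) * t))) (Ici 0) t := fun t ht => by
    have hexp : HasDerivAt (fun s => Real.exp (-(2 * μ) * s))
        (Real.exp (-(2 * μ) * t) * -(2 * μ)) t := by
      simpa using ((hasDerivAt_id t).const_mul (-(2 * μ))).exp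
    refine (hp.hasDerivWithinAt_dotProduct_self t ht).add
      ((hexp.const_mul _).congr_deriv ?_).hasDerivWithinAt
    field_simp
  refine antitoneOn_of_hasDerivWithinAt_nonpos (convex_Ici 0)
    (fun t ht => (hderiv t ht).continuousWithinAt)
    (fun t ht => (hderiv t (interior_subset ht)).mono interior_subset) fun t ht => ?_
  have hd2 : d t ^ 2 ≤ K ^ 2 * Real.exp (-(2 * μ) * t) := by
    calc d t ^ 2 = |d t| ^ 2 := (sq_abs _).symm
      _ ≤ (K * Real.exp (-μ * t)) ^ 2 := by gcongr; exact hd t (interior_subset ht)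
      _ = K ^ 2 * Real.exp (-(2 * μ) * t) := by rw [mul_pow, ← Real.exp_nat_mul]; ring_nf
  nlinarith [mul_le_mul_of_nonneg_left hd2 hγ.le,
    mul_nonneg hγ.le (sq_nonneg (d t + ω t ⬝ᵥ p t)), mul_nonneg hγ.le (sq_nonneg (ω t ⬝ᵥ p t))]

theorem boundedSignal_and_exists_tendsto (hγ : 0 < γ) (hd : ExpDecaying d)
    (hp : IsGradientSolution γ ω d p) :
    BoundedSignal p ∧ ∃ l, Tendsto (fun t => p t ⬝ᵥ p t) atTop (𝓝 l) := by
  obtain ⟨μ, hμ, K, hK⟩ := hd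
  set R : ℝ → ℝ := fun t => γ * K ^ 2 / (2 * μ) * Real.exp (-(2 * μ) * t)
  have hanti : AntitoneOn (fun t => p t ⬝ᵥ p t + R t) (Ici 0) :=
    hp.antitoneOn_dotProduct_self_add hγ hμ hK
  have hR : ∀ t, 0 ≤ R t := fun t => by positivity
  have hpp : ∀ t, 0 ≤ p t ⬝ᵥ p t := fun t => by simpa using dotProduct_star_self_nonneg (p t)
  refine ⟨⟨√(p 0 ⬝ᵥ p 0 + R 0), fun t ht => ?_⟩, ?_⟩
  · refine (norm_le_sqrt_dotProduct_self (p t)).trans (Real.sqrt_le_sqrt ?_)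
    exact (le_add_of_nonneg_right (hR t)).trans (hanti self_mem_Ici ht ht)
  · obtain ⟨l, hl⟩ := exists_tendsto_of_antitoneOn_Ici hanti
      ⟨0, by rintro _ ⟨t, -, rfl⟩; exact add_nonneg (hpp t) (hR t)⟩
    have hRlim : Tendsto R atTop (𝓝 0) :=
      mul_zero (γ * K ^ 2 / (2 * μ)) ▸
        (tendsto_exp_neg_mul_atTop (mul_pos two_pos hμ)).const_mul _
    exact ⟨l, by simpa using hl.sub hRlim⟩

theorem bddUniformContinuous (hp : IsGradientSolution γ ω d p) (hω : BoundedSignal ω)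
    (hd : BoundedSignal d) (hpb : BoundedSignal p) : BddUniformContinuous p :=
  .of_hasDerivWithinAt hpb hp ((hd.prodMk (hω.prodMk hpb)).comp
    (Φ := fun q : ℝ × (ι → ℝ) × (ι → ℝ) => -(γ * (q.1 + q.2.1 ⬝ᵥ q.2.2)) • q.2.1) (by fun_prop))

theorem tendsto_dotProduct (hγ : 0 < γ) (hω : BddUniformContinuous ω)
    (hd : BddUniformContinuous d) (hd0 : Tendsto d atTop (𝓝 0)) (hp : IsGradientSolution γ ω d p)
    (hpu : BddUniformContinuous p) {l : ℝ} (hl : Tendsto (fun t => p t ⬝ᵥ p t) atTop (𝓝 l)) :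
    Tendsto (fun t => ω t ⬝ᵥ p t) atTop (𝓝 0) := by
  have hq : BddUniformContinuous fun t => ω t ⬝ᵥ p t := hω.dotProduct hpu
  have hderiv : Tendsto (fun t => -2 * γ * ((d t + ω t ⬝ᵥ p t) * (ω t ⬝ᵥ p t))) atTop (𝓝 0) :=
    tendsto_deriv_zero_of_tendsto hp.hasDerivWithinAt_dotProduct_self
      ((hd.prodMk hq).comp (Φ := fun r : ℝ × ℝ => -2 * γ * ((r.1 + r.2) * r.2))
        (by fun_prop)).uniform hl
  have hdq : Tendsto (fun t => d t * (ω t ⬝ᵥ p t)) atTop (𝓝 0) :=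
    hq.bounded.tendsto_smul_zero hd0
  have hsq : Tendsto (fun t => (ω t ⬝ᵥ p t) ^ 2) atTop (𝓝 0) := by
    have h := (hderiv.const_mul (-1 / (2 * γ))).sub hdq
    rw [mul_zero, sub_zero] at h
    refine h.congr fun t => ?_
    field_simp
    ring
  rw [tendsto_zero_iff_abs_tendsto_zero]
  simpa [Real.sqrt_sq_eq_abs, Function.comp_def] using hsq.sqrt

theorem bddUniformContinuous_and_tendsto (hγ : 0 < γ) (hω : BddUniformContinuous ω)
    (hd : BddUniformContinuous d) (hde : ExpDecaying d) (hp : IsGradientSolution γ ω d p) :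
    BddUniformContinuous p ∧ Tendsto (fun t => ω t ⬝ᵥ p t) atTop (𝓝 0) := by
  obtain ⟨hpb, l, hl⟩ := hp.boundedSignal_and_exists_tendsto hγ hde
  have hpu := hp.bddUniformContinuous hω.bounded hd.bounded hpb
  exact ⟨hpu, hp.tendsto_dotProduct hγ hω hd hde.tendsto_zero hpu hl⟩

end IsGradientSolution

theorem abs_dotProduct_le (v w : ι → ℝ) : |v ⬝ᵥ w| ≤ Fintype.card ι * (‖v‖ * ‖w‖) := by
  calc |v ⬝ᵥ w| ≤ ∑ i, |v i * w i| := Finset.abs_sum_le_sum_abs _ _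
    _ ≤ ∑ _i : ι, ‖v‖ * ‖w‖ := by
        gcongr with i
        rw [abs_mul]
        gcongr
        exacts [norm_le_pi_norm v i, norm_le_pi_norm w i]
    _ = Fintype.card ι * (‖v‖ * ‖w‖) := by simp

theorem lipschitzWith_gradient (γ d : ℝ) (v : ι → ℝ) :
    LipschitzWith (Real.toNNReal (|γ| * (Fintype.card ι * ‖v‖ ^ 2)))
      fun p : ι → ℝ => -(γ * (d + v ⬝ᵥ p)) • v := by
  refine LipschitzWith.of_dist_le_mul fun p q => ?_
  rw [dist_eq_norm, dist_eq_norm, Real.coe_toNNReal _ (by positivity)]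
  calc ‖-(γ * (d + v ⬝ᵥ p)) • v - -(γ * (d + v ⬝ᵥ q)) • v‖
      = |γ| * |v ⬝ᵥ (p - q)| * ‖v‖ := by
        rw [← sub_smul, norm_smul, Real.norm_eq_abs, ← abs_mul, ← abs_neg, dotProduct_sub]
        ring_nf
    _ ≤ |γ| * (Fintype.card ι * (‖v‖ * ‖p - q‖)) * ‖v‖ := by
        gcongr
        exact abs_dotProduct_le _ _
    _ = |γ| * (Fintype.card ι * ‖v‖ ^ 2) * ‖p - q‖ := by ring

theorem exists_isGradientSolution (γ : ℝ) (hω : BddUniformContinuous ω)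
    (hd : BddUniformContinuous d) (p₀ : ι → ℝ) :
    ∃ p, p 0 = p₀ ∧ IsGradientSolution γ ω d p := by
  obtain ⟨M, hM⟩ := hω.bounded
  obtain ⟨B, hB⟩ := (hω.bounded.prodMk hd.bounded).comp
    (Φ := fun q : (ι → ℝ) × ℝ => -(γ * (q.2 + q.1 ⬝ᵥ 0)) • q.1) (by fun_prop)
  refine exists_solution_of_lipschitz_Ici (f := fun t v => -(γ * (d t + ω t ⬝ᵥ v)) • ω t)
    (K := Real.toNNReal (|γ| * (Fintype.card ι * M ^ 2))) ?_
    (fun t ht => (lipschitzWith_gradient γ (d t) (ω t)).weaken ?_) hB p₀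
  · have hrhs : Continuous fun q : (ι → ℝ) × ℝ × (ι → ℝ) =>
        -(γ * (q.2.1 + q.1 ⬝ᵥ q.2.2)) • q.1 := by fun_prop
    have hfst : MapsTo Prod.fst (Ici (0 : ℝ) ×ˢ (univ : Set (ι → ℝ))) (Ici 0) :=
      fun q hq => hq.1
    exact hrhs.comp_continuousOn ((hω.uniform.continuousOn.comp continuousOn_fst hfst).prodMk
      ((hd.uniform.continuousOn.comp continuousOn_fst hfst).prodMk continuousOn_snd))
  · gcongr
    exact hM t ht

end GradientLaw

section PersistentExcitation

variable {ι : Type*} [Fintype ι]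

theorem sq_dotProduct_eq_sum (v w : ι → ℝ) :
    (v ⬝ᵥ w) ^ 2 = ∑ i, ∑ j, w i * w j * (v i * v j) := by
  rw [sq, dotProduct, Finset.sum_mul_sum]
  exact Finset.sum_congr rfl fun i _ => Finset.sum_congr rfl fun j _ => by ring

theorem intervalIntegrable_finsetSum {g : ι → ℝ → ℝ} {a b : ℝ}
    (hg : ∀ i, IntervalIntegrable (g i) MeasureTheory.volume a b) :
    IntervalIntegrable (fun s => ∑ i, g i s) MeasureTheory.volume a b := by
  simpa only [Finset.sum_fn] using IntervalIntegrable.sum Finset.univ fun i _ => hg i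

theorem intervalIntegrable_sq_dotProduct {f : ℝ → ι → ℝ} {a b : ℝ}
    (hf : ∀ i j, IntervalIntegrable (fun s => f s i * f s j) MeasureTheory.volume a b)
    (v : ι → ℝ) :
    IntervalIntegrable (fun s => (f s ⬝ᵥ v) ^ 2) MeasureTheory.volume a b := by
  simp only [sq_dotProduct_eq_sum]
  exact intervalIntegrable_finsetSum fun i => intervalIntegrable_finsetSum fun j =>
    (hf i j).const_mul _

theorem integral_sq_dotProduct {f : ℝ → ι → ℝ} {a b : ℝ}
    (hf : ∀ i j, IntervalIntegrable (fun s => f s i * f s j) MeasureTheory.volume a b)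
    (v : ι → ℝ) :
    ∫ s in a..b, (f s ⬝ᵥ v) ^ 2 =
      v ⬝ᵥ (Matrix.of fun i j => ∫ s in a..b, f s i * f s j) *ᵥ v := by
  simp only [sq_dotProduct_eq_sum]
  rw [intervalIntegral.integral_finsetSum fun i _ =>
    intervalIntegrable_finsetSum fun j => (hf i j).const_mul _]
  simp only [dotProduct, mulVec, of_apply, Finset.mul_sum]
  refine Finset.sum_congr rfl fun i _ => ?_
  rw [intervalIntegral.integral_finsetSum fun j _ => (hf i j).const_mul _]
  refine Finset.sum_congr rfl fun j _ => ?_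
  rw [intervalIntegral.integral_const_mul]
  ring

theorem BoundedSignal.intervalIntegrable_mul {f : ℝ → ι → ℝ} (hf : BoundedSignal f)
    (hfm : Measurable fun t : Ici (0 : ℝ) => f t) {a b : ℝ} (ha : 0 ≤ a) (hab : a ≤ b) (i j : ι) :
    IntervalIntegrable (fun s => f s i * f s j) MeasureTheory.volume a b := by
  obtain ⟨M, hM⟩ := hf
  have hsub : Ioc a b ⊆ Ici 0 := fun s hs => ha.trans hs.1.le
  have hmeas : AEMeasurable (fun s => f s i * f s j)
      (MeasureTheory.volume.restrict (Ici 0)) :=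
    aemeasurable_restrict_of_measurable_subtype measurableSet_Ici
      ((measurable_pi_iff.1 hfm i).mul (measurable_pi_iff.1 hfm j))
  rw [intervalIntegrable_iff_integrableOn_Ioc_of_le hab]
  refine .of_bound measure_Ioc_lt_top (hmeas.mono_set hsub).aestronglyMeasurable (M * M) ?_
  refine (MeasureTheory.ae_restrict_iff' measurableSet_Ioc).2 (.of_forall fun s hs => ?_)
  rw [norm_mul]
  have hs' := hM s (hsub hs)
  exact mul_le_mul ((norm_le_pi_norm _ i).trans hs') ((norm_le_pi_norm _ j).trans hs')
    (norm_nonneg _) ((norm_nonneg _).trans hs')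

theorem eventually_norm_sub_le_of_tendsto_deriv_zero {E : Type*} [NormedAddCommGroup E]
    [NormedSpace ℝ E] {p p' : ℝ → E} (hp : ∀ t : ℝ, 0 ≤ t → HasDerivWithinAt p (p' t) (Ici 0) t)
    (hp' : Tendsto p' atTop (𝓝 0)) {T ε : ℝ} (hT : 0 < T) (hε : 0 < ε) :
    ∀ᶠ t in atTop, ∀ s ∈ Icc t (t + T), ‖p t - p s‖ ≤ ε := by
  rw [NormedAddGroup.tendsto_nhds_zero] at hp'
  obtain ⟨t₀, ht₀⟩ := eventually_atTop.1 (hp' (ε / T) (div_pos hε hT))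
  filter_upwards [eventually_ge_atTop t₀, eventually_ge_atTop 0] with t ht ht0 s hs
  have h := (convex_Icc t (t + T)).norm_image_sub_le_of_norm_hasDerivWithin_le (f := p) (x := s)
    (fun r hr => (hp r (ht0.trans hr.1)).mono fun q hq => ht0.trans hq.1)
    (fun r hr => (ht₀ r (ht.trans hr.1)).le) hs (left_mem_Icc.2 (by linarith))
  have hts : ‖t - s‖ ≤ T := by
    rw [norm_sub_rev, Real.norm_of_nonneg (sub_nonneg.2 hs.1)]
    linarith [hs.2]
  calc ‖p t - p s‖ ≤ ε / T * ‖t - s‖ := h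
    _ ≤ ε / T * T := by gcongr
    _ = ε := div_mul_cancel₀ ε hT.ne'

theorem eventually_abs_dotProduct_le_of_tendsto {f p p' : ℝ → ι → ℝ} (hf : BoundedSignal f)
    (hp : ∀ t : ℝ, 0 ≤ t → HasDerivWithinAt p (p' t) (Ici 0) t) (hp' : Tendsto p' atTop (𝓝 0))
    (hfp : Tendsto (fun t => f t ⬝ᵥ p t) atTop (𝓝 0)) {T ε : ℝ} (hT : 0 < T) (hε : 0 < ε) :
    ∀ᶠ t in atTop, ∀ s ∈ Icc t (t + T), |f s ⬝ᵥ p t| ≤ ε := by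
  obtain ⟨M, hM⟩ := hf
  have hM0 : 0 ≤ M := (norm_nonneg _).trans (hM 0 le_rfl)
  set C : ℝ := Fintype.card ι * M + 1 with hC
  rw [NormedAddGroup.tendsto_nhds_zero] at hfp
  obtain ⟨t₀, ht₀⟩ := eventually_atTop.1 (hfp (ε / 2) (half_pos hε))
  filter_upwards [eventually_norm_sub_le_of_tendsto_deriv_zero hp hp' hT
    (show 0 < ε / 2 / C by positivity), eventually_ge_atTop t₀, eventually_ge_atTop 0]
    with t hslow ht ht0 s hs
  have hvary : |f s ⬝ᵥ (p t - p s)| ≤ ε / 2 := by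
    calc |f s ⬝ᵥ (p t - p s)| ≤ Fintype.card ι * (‖f s‖ * ‖p t - p s‖) := abs_dotProduct_le _ _
      _ ≤ Fintype.card ι * (M * (ε / 2 / C)) := by
          gcongr
          exacts [hM s (ht0.trans hs.1), hslow s hs]
      _ = Fintype.card ι * M * (ε / 2 / C) := (mul_assoc _ _ _).symm
      _ ≤ C * (ε / 2 / C) := by gcongr; linarith
      _ = ε / 2 := mul_div_cancel₀ _ (by positivity)
  calc |f s ⬝ᵥ p t| = |f s ⬝ᵥ p s + f s ⬝ᵥ (p t - p s)| := by rw [dotProduct_sub]; ring_nf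
    _ ≤ ε / 2 + ε / 2 := (abs_add_le _ _).trans (add_le_add (ht₀ s (ht.trans hs.1)).le hvary)
    _ = ε := add_halves ε

theorem PersistentlyExciting.tendsto_zero {m : ℕ} {f p p' : ℝ → Fin m → ℝ}
    (hf : PersistentlyExciting f)
    (hp : ∀ t : ℝ, 0 ≤ t → HasDerivWithinAt p (p' t) (Ici 0) t)
    (hp' : Tendsto p' atTop (𝓝 0)) (hfp : Tendsto (fun t => f t ⬝ᵥ p t) atTop (𝓝 0)) :
    Tendsto p atTop (𝓝 0) := by
  obtain ⟨hfm, hfb, α, T, hα, hT, hPE⟩ := hf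
  rw [NormedAddGroup.tendsto_nhds_zero]
  intro ε hε
  obtain ⟨δ, hδ, hδ0⟩ : ∃ δ : ℝ, T * δ ^ 2 < α * ε ^ 2 ∧ 0 < δ := by
    have hcont : Continuous fun δ : ℝ => T * δ ^ 2 := by fun_prop
    have hlim : Tendsto (fun δ : ℝ => T * δ ^ 2) (𝓝[>] 0) (𝓝 0) := by
      simpa using (hcont.tendsto 0).mono_left nhdsWithin_le_nhds
    exact ((hlim.eventually (gt_mem_nhds (by positivity))).and self_mem_nhdsWithin).exists
  filter_upwards [eventually_abs_dotProduct_le_of_tendsto hfb hp hp' hfp hT hδ0,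
    eventually_ge_atTop 0] with t hsmall ht
  have htT : t ≤ t + T := by linarith
  have hint := hfb.intervalIntegrable_mul hfm ht htT
  have hlower : α * (p t ⬝ᵥ p t) ≤ ∫ s in t..(t + T), (f s ⬝ᵥ p t) ^ 2 := by
    have h := (hPE t ht).dotProduct_mulVec_nonneg (p t)
    rw [sub_mulVec, dotProduct_sub, smul_mulVec, one_mulVec, dotProduct_smul] at h
    rw [integral_sq_dotProduct hint]
    simpa using h
  have hupper : ∫ s in t..(t + T), (f s ⬝ᵥ p t) ^ 2 ≤ T * δ ^ 2 := by
    have h := intervalIntegral.integral_mono_on htT (intervalIntegrable_sq_dotProduct hint (p t))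
      (intervalIntegrable_const (c := δ ^ 2)) fun s hs =>
        sq_le_sq' (abs_le.1 (hsmall s hs)).1 (abs_le.1 (hsmall s hs)).2
    simpa using h
  refine (norm_le_sqrt_dotProduct_self (p t)).trans_lt ((Real.sqrt_lt' hε).2 ?_)
  exact lt_of_mul_lt_mul_left ((hlower.trans hupper).trans_lt hδ) hα.le

end PersistentExcitation

section Swapping

variable {n : ℕ} {ι : Type*} [Fintype ι] {F : Matrix (Fin n) (Fin n) ℝ} {b : Fin n → ℝ}
  {f p p' : ℝ → ι → ℝ} {Ω : ι → ℝ → Fin n → ℝ} {z : ℝ → Fin n → ℝ}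

theorem dotProduct_sum_smul (c : Fin n → ℝ) (v : ι → ℝ) (w : ι → Fin n → ℝ) :
    c ⬝ᵥ (∑ i, v i • w i) = (fun i => c ⬝ᵥ w i) ⬝ᵥ v := by
  rw [dotProduct_sum, dotProduct]
  exact Finset.sum_congr rfl fun i _ => by rw [dotProduct_smul, smul_eq_mul, mul_comm]

theorem hasDerivWithinAt_sum_smul_of_isFilterState
    (hΩ : ∀ i, IsFilterState F b (fun t => f t i) (Ω i)) {t : ℝ} (ht : 0 ≤ t)
    (hp : HasDerivWithinAt p (p' t) (Ici 0) t) :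
    HasDerivWithinAt (fun t => ∑ i, p t i • Ω i t)
      (F *ᵥ (∑ i, p t i • Ω i t) + (f t ⬝ᵥ p t) • b + ∑ i, p' t i • Ω i t) (Ici 0) t := by
  have h := HasDerivWithinAt.fun_sum (u := Finset.univ) fun i _ =>
    (hasDerivWithinAt_pi.1 hp i).smul (hΩ i t ht)
  refine h.congr_deriv ?_
  simp only [mulVec_sum, dotProduct, Finset.sum_smul, ← Finset.sum_add_distrib, mulVec_smul,
    smul_add, smul_smul, mul_comm (f t _)]

theorem IsFilterState.hasDerivWithinAt_sub_sum_smul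
    (hz : IsFilterState F b (fun t => f t ⬝ᵥ p t) z)
    (hΩ : ∀ i, IsFilterState F b (fun t => f t i) (Ω i)) {t : ℝ} (ht : 0 ≤ t)
    (hp : HasDerivWithinAt p (p' t) (Ici 0) t) :
    HasDerivWithinAt (fun t => z t - ∑ i, p t i • Ω i t)
      (F *ᵥ (z t - ∑ i, p t i • Ω i t) + -∑ i, p' t i • Ω i t) (Ici 0) t := by
  refine ((hz t ht).sub (hasDerivWithinAt_sum_smul_of_isFilterState hΩ ht hp)).congr_deriv ?_
  rw [mulVec_sub]
  abel

theorem bddUniformContinuous_dotProduct_of_isFilterState (hF : IsHurwitz F)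
    (hΩ : ∀ i, IsFilterState F b (fun t => f t i) (Ω i)) (hf : BoundedSignal f)
    (c : Fin n → ℝ) : BddUniformContinuous fun t i => c ⬝ᵥ Ω i t :=
  .pi fun i => ((hΩ i).bddUniformContinuous hF (boundedSignal_pi.1 hf i)).const_dotProduct c

theorem IsFilterState.tendsto_dotProduct_sub (hF : IsHurwitz F)
    (hz : IsFilterState F b (fun t => f t ⬝ᵥ p t) z)
    (hΩ : ∀ i, IsFilterState F b (fun t => f t i) (Ω i)) (hf : BoundedSignal f)
    (hp : ∀ t : ℝ, 0 ≤ t → HasDerivWithinAt p (p' t) (Ici 0) t) (hp' : Tendsto p' atTop (𝓝 0))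
    (c : Fin n → ℝ) :
    Tendsto (fun t => c ⬝ᵥ z t - (fun i => c ⬝ᵥ Ω i t) ⬝ᵥ p t) atTop (𝓝 0) := by
  have hforcing : Tendsto (fun t => -∑ i, p' t i • Ω i t) atTop (𝓝 0) := by
    have h : Tendsto (fun t => ∑ i, p' t i • Ω i t) atTop (𝓝 (∑ _i : ι, 0)) :=
      tendsto_finsetSum _ fun i _ =>
        ((hΩ i).bddUniformContinuous hF (boundedSignal_pi.1 hf i)).bounded.tendsto_smul_zero
          (tendsto_pi_nhds.1 hp' i)
    simpa using h.neg
  have h := hF.tendsto_dotProduct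
    (fun t ht => hz.hasDerivWithinAt_sub_sum_smul hΩ ht (hp t ht)) hforcing c
  simpa only [dotProduct_sub, dotProduct_sum_smul] using h

end Swapping

section ClosedLoop

variable {n m : ℕ} {P : Plant n m} {k : Fin n → ℝ} {γ : ℝ} {θ : Fin m → ℝ} {S : Signals n m}

theorem Plant.F_mulVec (P : Plant n m) (k v : Fin n → ℝ) :
    P.F k *ᵥ v = P.A *ᵥ v - (P.c ⬝ᵥ v) • k := by
  simp [Plant.F, sub_mulVec, vecMulVec_mulVec]

theorem Plant.IsMasterSolution.bddUniformContinuous (hφ₀ : Continuous P.φ₀)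
    (hφ : Continuous P.φ) {x : ℝ → Fin n → ℝ} (hx : P.IsMasterSolution θ x)
    (hb : BoundedSignal x) : BddUniformContinuous x :=
  .of_hasDerivWithinAt hb hx (hb.comp
    (Φ := fun x => P.A *ᵥ x + P.φ₀ (P.c ⬝ᵥ x) + (P.φ (P.c ⬝ᵥ x) ⬝ᵥ θ) • P.b) (by fun_prop))

theorem Plant.IsMasterSolution.bddUniformContinuous_regressor (hφ₀ : Continuous P.φ₀)
    (hφ : Continuous P.φ) {x : ℝ → Fin n → ℝ} (hx : P.IsMasterSolution θ x)
    (hb : BoundedSignal x) : BddUniformContinuous fun t => P.φ (P.c ⬝ᵥ x t) :=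
  (hx.bddUniformContinuous hφ₀ hφ hb).comp (Φ := fun x => P.φ (P.c ⬝ᵥ x)) (by fun_prop)

namespace Signals

/-- The state of the unforced system `δ' = F δ` that separates the augmented error `ê` from its
regression form `ωᵀ (θ - θhat)`. -/
def mismatch (S : Signals n m) (θ : Fin m → ℝ) (t : ℝ) : Fin n → ℝ :=
  S.x t - S.xhat t + S.ζ t - ∑ i, θ i • S.Ω i t

theorem ehat_eq (S : Signals n m) (P : Plant n m) (θ : Fin m → ℝ) (t : ℝ) :
    S.ehat P t = P.c ⬝ᵥ S.mismatch θ t + S.ω P t ⬝ᵥ (θ - S.θhat t) := by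
  have hω : S.ω P t = fun i => P.c ⬝ᵥ S.Ω i t := rfl
  simp only [ehat, e, y, yhat, χ, mismatch, dotProduct_add, dotProduct_sub,
    dotProduct_sum_smul, hω]
  ring

theorem dotProduct_x_sub_xhat (S : Signals n m) (P : Plant n m) (t : ℝ) :
    P.c ⬝ᵥ (S.x t - S.xhat t) = S.e P t :=
  dotProduct_sub _ _ _

namespace IsClosedLoop

theorem isFilterState_x_sub_xhat (h : S.IsClosedLoop P k γ θ) :
    IsFilterState (P.F k) P.b (fun t => S.regressor P t ⬝ᵥ (θ - S.θhat t))
      (fun t => S.x t - S.xhat t) := fun t ht => by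
  refine ((h.master t ht).sub (h.observer t ht)).congr_deriv ?_
  simp only [P.F_mulVec, mulVec_sub, dotProduct_sub, sub_smul, y, yhat, regressor]
  abel

theorem hasDerivWithinAt_mismatch (h : S.IsClosedLoop P k γ θ) (t : ℝ) (ht : 0 ≤ t) :
    HasDerivWithinAt (S.mismatch θ) (P.F k *ᵥ S.mismatch θ t) (Ici 0) t := by
  have hsum : IsFilterState (P.F k) P.b (fun t => S.regressor P t ⬝ᵥ θ)
      (fun t => S.x t - S.xhat t + S.ζ t) := fun t ht => by
    refine ((h.isFilterState_x_sub_xhat t ht).add (h.filterζ t ht)).congr_deriv ?_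
    simp only [mulVec_add, dotProduct_sub, sub_smul]
    abel
  refine (hsum.hasDerivWithinAt_sub_sum_smul (p := fun _ => θ) (p' := 0) h.filterΩ ht
    (hasDerivWithinAt_const t (Ici 0) θ)).congr_deriv ?_
  simp [mismatch]

theorem isGradientSolution (h : S.IsClosedLoop P k γ θ) :
    IsGradientSolution γ (S.ω P) (fun t => P.c ⬝ᵥ S.mismatch θ t) fun t => θ - S.θhat t :=
  fun t ht => by
    rw [← ehat_eq, neg_smul]
    exact (h.adaptation t ht).const_sub θ

theorem of_isGradientSolution (hx : P.IsMasterSolution θ S.x)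
    (hΩ : ∀ i, IsFilterState (P.F k) P.b (fun t => S.regressor P t i) (S.Ω i))
    (hζ : IsFilterState (P.F k) P.b (fun t => S.regressor P t ⬝ᵥ S.θhat t) S.ζ)
    (hδ : ∀ t : ℝ, 0 ≤ t →
      HasDerivWithinAt (S.mismatch θ) (P.F k *ᵥ S.mismatch θ t) (Ici 0) t)
    (hp : IsGradientSolution γ (S.ω P) (fun t => P.c ⬝ᵥ S.mismatch θ t) fun t => θ - S.θhat t) :
    S.IsClosedLoop P k γ θ where
  master := hx
  filterΩ := hΩ
  filterζ := hζ
  observer t ht := by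
    have hxhat : S.xhat = fun t => S.x t - (S.mismatch θ t - S.ζ t + ∑ i, θ i • S.Ω i t) := by
      funext t
      simp only [mismatch]
      abel
    have hsum := hasDerivWithinAt_sum_smul_of_isFilterState (p := fun _ => θ) (p' := 0) hΩ ht
      (hasDerivWithinAt_const t (Ici 0) θ)
    have hderiv := (hx t ht).fun_sub (((hδ t ht).fun_sub (hζ t ht)).fun_add hsum)
    rw [← hxhat] at hderiv
    refine hderiv.congr_deriv ?_
    simp only [mismatch, P.F_mulVec, mulVec_add, mulVec_sub, dotProduct_sub, dotProduct_add,
      sub_smul, add_smul, Pi.zero_apply, zero_smul, Finset.sum_const_zero, y, yhat, regressor]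
    abel
  adaptation t ht := by
    simpa [ehat_eq S P θ] using (hp t ht).const_sub θ

theorem boundedSignal_x (hP : P.HasBoundedStates) (h : S.IsClosedLoop P k γ θ) :
    BoundedSignal S.x :=
  (hP θ (S.x 0)).2 S.x h.master rfl

theorem bddUniformContinuous_regressor (hφ₀ : Continuous P.φ₀) (hφ : Continuous P.φ)
    (hP : P.HasBoundedStates) (h : S.IsClosedLoop P k γ θ) :
    BddUniformContinuous (S.regressor P) :=
  h.master.bddUniformContinuous_regressor hφ₀ hφ (h.boundedSignal_x hP)

theorem bddUniformContinuous_ω (hF : IsHurwitz (P.F k)) (h : S.IsClosedLoop P k γ θ)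
    (hreg : BoundedSignal (S.regressor P)) : BddUniformContinuous (S.ω P) :=
  bddUniformContinuous_dotProduct_of_isFilterState hF h.filterΩ hreg P.c

theorem bddUniformContinuous_and_tendsto (hF : IsHurwitz (P.F k)) (hγ : 0 < γ)
    (h : S.IsClosedLoop P k γ θ) (hreg : BoundedSignal (S.regressor P)) :
    BddUniformContinuous (fun t => θ - S.θhat t) ∧
      Tendsto (fun t => S.ω P t ⬝ᵥ (θ - S.θhat t)) atTop (𝓝 0) :=
  h.isGradientSolution.bddUniformContinuous_and_tendsto hγ (h.bddUniformContinuous_ω hF hreg)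
    ((hF.bddUniformContinuous h.hasDerivWithinAt_mismatch).const_dotProduct P.c)
    (hF.expDecaying_dotProduct h.hasDerivWithinAt_mismatch P.c)

theorem tendsto_ehat (hF : IsHurwitz (P.F k)) (hγ : 0 < γ) (h : S.IsClosedLoop P k γ θ)
    (hreg : BoundedSignal (S.regressor P)) : Tendsto (S.ehat P) atTop (𝓝 0) := by
  have hδ := (hF.expDecaying_dotProduct h.hasDerivWithinAt_mismatch P.c).tendsto_zero
  have hωp := (h.bddUniformContinuous_and_tendsto hF hγ hreg).2
  have hsum := hδ.add hωp
  rw [add_zero] at hsum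
  exact hsum.congr fun t => (S.ehat_eq P θ t).symm

theorem tendsto_deriv_parameterError (hF : IsHurwitz (P.F k)) (hγ : 0 < γ)
    (h : S.IsClosedLoop P k γ θ) (hreg : BoundedSignal (S.regressor P)) :
    Tendsto (fun t => -((γ * S.ehat P t) • S.ω P t)) atTop (𝓝 0) := by
  have hγe : Tendsto (fun t => γ * S.ehat P t) atTop (𝓝 0) := by
    simpa using (h.tendsto_ehat hF hγ hreg).const_mul γ
  simpa using ((h.bddUniformContinuous_ω hF hreg).bounded.tendsto_smul_zero hγe).neg

theorem tendsto_e (hF : IsHurwitz (P.F k)) (hγ : 0 < γ) (h : S.IsClosedLoop P k γ θ)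
    (hreg : BoundedSignal (S.regressor P)) : Tendsto (S.e P) atTop (𝓝 0) := by
  have hswap : Tendsto (fun t => P.c ⬝ᵥ (S.x t - S.xhat t) - S.ω P t ⬝ᵥ (θ - S.θhat t)) atTop
      (𝓝 0) :=
    h.isFilterState_x_sub_xhat.tendsto_dotProduct_sub hF h.filterΩ hreg
      (fun t ht => (h.adaptation t ht).const_sub θ)
      (h.tendsto_deriv_parameterError hF hγ hreg) P.c
  have hsum := hswap.add (h.bddUniformContinuous_and_tendsto hF hγ hreg).2
  rw [add_zero] at hsum
  exact hsum.congr fun t => by rw [sub_add_cancel, dotProduct_x_sub_xhat]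

theorem tendsto_parameterError (hF : IsHurwitz (P.F k)) (hγ : 0 < γ)
    (h : S.IsClosedLoop P k γ θ) (hreg : BddUniformContinuous (S.regressor P))
    (hPE : PersistentlyExciting (S.regressor P)) (hH : IsMinimumPhase (P.F k) P.b P.c) :
    Tendsto (fun t => θ - S.θhat t) atTop (𝓝 0) := by
  have hp := (h.bddUniformContinuous_and_tendsto hF hγ hreg.bounded).1
  have hφp : Tendsto (fun t => S.regressor P t ⬝ᵥ (θ - S.θhat t)) atTop (𝓝 0) :=
    hH.tendsto_input hF (hreg.dotProduct hp) h.isFilterState_x_sub_xhat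
      (by simpa only [dotProduct_x_sub_xhat] using h.tendsto_e hF hγ hreg.bounded)
  exact hPE.tendsto_zero (fun t ht => (h.adaptation t ht).const_sub θ)
    (h.tendsto_deriv_parameterError hF hγ hreg.bounded) hφp

theorem allBounded (hφ₀ : Continuous P.φ₀) (hF : IsHurwitz (P.F k)) (hγ : 0 < γ)
    (h : S.IsClosedLoop P k γ θ) (hx : BoundedSignal S.x)
    (hreg : BoundedSignal (S.regressor P)) : S.AllBounded P := by
  have hp := (h.bddUniformContinuous_and_tendsto hF hγ hreg).1.bounded
  have hθhat : BoundedSignal S.θhat := by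
    simpa using hp.comp (Φ := fun v => θ - v) (by fun_prop)
  have hζ : BoundedSignal S.ζ :=
    (h.filterζ.bddUniformContinuous hF (hreg.dotProduct hθhat)).bounded
  have hε : BoundedSignal fun t => S.x t - S.xhat t :=
    (h.isFilterState_x_sub_xhat.bddUniformContinuous hF (hreg.dotProduct hp)).bounded
  have hxhat : BoundedSignal S.xhat := by simpa using hx.sub hε
  have hy : BoundedSignal (S.y P) := hx.const_dotProduct P.c
  have hyhat : BoundedSignal (S.yhat P) := hxhat.const_dotProduct P.c
  have hχ : BoundedSignal (S.χ P) := hζ.const_dotProduct P.c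
  have hω : BoundedSignal (S.ω P) := (h.bddUniformContinuous_ω hF hreg).bounded
  exact {
    x := hx
    xhat := hxhat
    θhat := hθhat
    Ω := fun i => ((h.filterΩ i).bddUniformContinuous hF (boundedSignal_pi.1 hreg i)).bounded
    ζ := hζ
    y := hy
    yhat := hyhat
    e := hy.sub hyhat
    φ₀ := hy.comp hφ₀
    regressor := hreg
    ω := hω
    χ := hχ
    ehat := ((hy.sub hyhat).add hχ).sub (hω.dotProduct hθhat) }

end IsClosedLoop

theorem exists_isClosedLoop (hφ₀ : Continuous P.φ₀) (hφ : Continuous P.φ)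
    (hP : P.HasBoundedStates) (hF : IsHurwitz (P.F k)) (hγ : 0 < γ) (θ : Fin m → ℝ)
    (x₀ xhat₀ : Fin n → ℝ) (θhat₀ : Fin m → ℝ) (Ω₀ : Fin m → Fin n → ℝ) (ζ₀ : Fin n → ℝ) :
    ∃ S : Signals n m, S.IsClosedLoop P k γ θ ∧ S.x 0 = x₀ ∧ S.xhat 0 = xhat₀ ∧
      S.θhat 0 = θhat₀ ∧ (∀ i, S.Ω i 0 = Ω₀ i) ∧ S.ζ 0 = ζ₀ := by
  obtain ⟨⟨x, hx, hx0⟩, hxb⟩ := hP θ x₀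
  have hreg := hx.bddUniformContinuous_regressor hφ₀ hφ (hxb x hx hx0)
  choose Ω hΩ hΩ0 using fun i => exists_isFilterState (P.F k) P.b
    (hreg.comp (Φ := fun v => v i) (by fun_prop)) (Ω₀ i)
  obtain ⟨δ, hδ, hδ0⟩ : ∃ δ : ℝ → Fin n → ℝ,
      (∀ t : ℝ, 0 ≤ t → HasDerivWithinAt δ (P.F k *ᵥ δ t) (Ici 0) t) ∧
        δ 0 = x₀ - xhat₀ + ζ₀ - ∑ i, θ i • Ω₀ i := by
    simpa [IsFilterState] using exists_isFilterState (P.F k) 0 (u := fun _ => 0)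
      ⟨⟨0, by simp⟩, uniformContinuous_const.uniformContinuousOn⟩ _
  have hω := bddUniformContinuous_dotProduct_of_isFilterState hF hΩ hreg.bounded P.c
  have hd := (hF.bddUniformContinuous hδ).const_dotProduct P.c
  obtain ⟨p, hp0, hp⟩ := exists_isGradientSolution γ hω hd (θ - θhat₀)
  have hpu := (hp.bddUniformContinuous_and_tendsto hγ hω hd (hF.expDecaying_dotProduct hδ P.c)).1
  obtain ⟨ζ, hζ, hζ0⟩ := exists_isFilterState (P.F k) P.b
    (hreg.dotProduct (hpu.comp (Φ := fun v => θ - v) (by fun_prop))) ζ₀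
  let S : Signals n m :=
    { x := x
      xhat := fun t => x t - (δ t - ζ t + ∑ i, θ i • Ω i t)
      θhat := fun t => θ - p t
      Ω := Ω
      ζ := ζ }
  have hmismatch : S.mismatch θ = δ := by
    funext t
    simp only [S, mismatch]
    abel
  have herror : (fun t => θ - S.θhat t) = p := funext fun t => sub_sub_cancel θ (p t)
  refine ⟨S, .of_isGradientSolution hx hΩ hζ (by rwa [hmismatch])
    (by rwa [hmismatch, herror]), hx0, ?_, ?_, hΩ0, hζ0⟩
  · simp only [S, hx0, hδ0, hζ0, hΩ0]
    abel
  · simp [S, hp0]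

end Signals

end ClosedLoop

theorem theorem1 {n m : ℕ} (P : Plant n m)
    (hφ₀ : Continuous P.φ₀) (hφ : Continuous P.φ)
    (hP : P.HasBoundedStates)
    (k : Fin n → ℝ) (hF : IsHurwitz (P.F k)) :
    ∀ (γ : ℝ), 0 < γ → ∀ θ : Fin m → ℝ,
      -- from all initial conditions the closed loop has a solution on the whole of `[0, ∞)`
      (∀ (x₀ xhat₀ : Fin n → ℝ) (θhat₀ : Fin m → ℝ) (Ω₀ : Fin m → Fin n → ℝ) (ζ₀ : Fin n → ℝ),
        ∃ S : Signals n m, S.IsClosedLoop P k γ θ ∧ S.x 0 = x₀ ∧ S.xhat 0 = xhat₀ ∧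
          S.θhat 0 = θhat₀ ∧ (∀ i, S.Ω i 0 = Ω₀ i) ∧ S.ζ 0 = ζ₀) ∧
      -- and every solution, whatever its initial conditions, has properties (i) and (ii)
      ∀ S : Signals n m, S.IsClosedLoop P k γ θ →
        (S.AllBounded P ∧ Tendsto (fun t => S.y P t - S.yhat P t) atTop (𝓝 0)) ∧
        (PersistentlyExciting (S.regressor P) → IsMinimumPhase (P.F k) P.b P.c →
          Tendsto (fun t => ‖WithLp.toLp 2 (θ - S.θhat t)‖) atTop (𝓝 0)) := by
  intro γ hγ θ
  refine ⟨Signals.exists_isClosedLoop hφ₀ hφ hP hF hγ θ, fun S h => ?_⟩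
  have hreg := h.bddUniformContinuous_regressor hφ₀ hφ hP
  have hbounded := h.allBounded hφ₀ hF hγ (h.boundedSignal_x hP) hreg.bounded
  refine ⟨⟨hbounded, h.tendsto_e hF hγ hreg.bounded⟩, fun hPE hH => ?_⟩
  have hp := h.tendsto_parameterError hF hγ hreg hPE hH
  simpa using (((PiLp.continuous_toLp 2 _).tendsto 0).comp hp).norm
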